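/- Let $\mathcal H$ be a separable complex Hilbert space, $\Lambda$ a finite or countably infinite set, and $\mathcal K$ a Hilbert space with orthonormal basis $(|i\rangle)_{i\in\Lambda}$. For $i,j\in\Lambda$ let $B^i_j$ be a bounded operator on $\mathcal H$ such that $\sum_i (B^i_j)^*B^i_j=I$ strongly for every $j$; put $M^i_j=B^i_j\otimes|i\rangle\langle j|$ and $\mathcal M(\rho)=\sum_{i,j}M^i_j\,\rho\,(M^i_j)^*$ (an open quantum random walk). Let $\rho^{(0)}=\sum_i\rho^{(0)}_i\otimes|i\rangle\langle i|$, where the $\rho^{(0)}_i\ge 0$ are trace class operators on $\mathcal H$ with $\sum_i\mathrm{Tr}(\rho^{(0)}_i)=1$, and let $\rho^{(n)}=\mathcal M^n(\rho^{(0)})$, with diagonal blocks $\rho^{(n)}_j$, so that $\rho^{(n)}=\sum_j\rho^{(n)}_j\otimes|j\rangle\langle j|$. Let $\mathcal B\subset\mathcal B(\mathcal H\otimes\mathcal K)$ be the von Neumann algebra generated by the operators $\sum_i a(i)\otimes|i\rangle\langle i|$ with $\sum_i\|a(i)\|<\infty$. Let $\mathcal A=\bigotimes_{k\ge0}\mathcal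 B$ be the infinite tensor product, i.e. the norm closure of the union of the finite von Neumann tensor products $\mathcal A_{n]}=\mathcal B^{\bar\otimes(n+1)}\otimes I\otimes I\otimes\cdots$. For $x,y\in\mathcal B$ put $$\mathcal E^{(n)}(x\otimes y)=\sum_{j:\rho^{(n)}_j\ne0}\ \sum_{i\in\Lambda}\frac{\mathrm{Tr}\big((\rho^{(n)}_j\otimes|j\rangle\langle j|)\,x\big)}{\mathrm{Tr}(\rho^{(n)}_j)}\,(M^i_j)^*\,y\,M^i_j$$ (strongly convergent sum). Let $$\bar b(n)=\lim_{k\to\infty}\mathcal E^{(n)}\big(I\otimes\mathcal E^{(n+1)}(I\otimes\cdots\otimes\mathcal E^{(n+k)}(I\otimes I))\big)$$ in the strong operator topology. For $a_0,a_1,\dots\in\mathcal B$ put $$E_{0]}(a_0\otimes\cdots\otimes a_n\otimes I\otimes\cdots)=\mathcal E^{(0)}\big(a_0\otimes\mathcal E^{(1)}(a_1\otimes\cdots\otimes\mathcal E^{(n)}(a_n\otimes\bar b(n+1)))\big),$$ $$E_{0]}(a_0\otimes a_1\otimes\cdots)=\lim_{n\to\infty}E_{0]}(a_0\otimes\cdots\otimes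 a_n\otimes I\otimes\cdots)$$ when this strong limit exists, and $\rho(a)=\mathrm{Tr}\big(\rho^{(0)}E_{0]}(a)\big)$. Then: 1. Every $\rho^{(n)}$ is a density operator (positive, trace class, of trace one), and for every $n\ge0$ and $x\in\mathcal B$ $$\rho(I\otimes\cdots\otimes I\otimes\overset{n\text{th}}{x}\otimes I\otimes\cdots)=\mathrm{Tr}(\rho^{(n)}x).$$ 2. The pair $(\rho^{(0)},(\mathcal E^{(n)})_{n\ge0})$ is a Markov pair: $x\mapsto\mathrm{Tr}(\rho^{(0)}x)$ is a state on $\mathcal B$; each $\mathcal E^{(n)}$ is a transition expectation, i.e. it takes values in $\mathcal B$, is bilinear and completely positive on $\mathcal B\otimes\mathcal B$, and satisfies $\mathcal E^{(n)}(I\otimes I)\le I$; one has $\rho(I\otimes I\otimes\cdots)=1$; and $\rho$ defines a state on $\mathcal A$. More precisely, there is a state on $\mathcal A$, normal on each $\mathcal A_{n]}$, whose value at every $a_0\otimes\cdots\otimes a_n\otimes I\otimes\cdots$ with $a_k\in\mathcal B$ is $\mathrm{Tr}\big(\rho^{(0)}E_{0]}(a_0\otimes\cdots\otimes a_n\otimes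 I\otimes\cdots)\big)$; in particular its value at $I\otimes\cdots\otimes I\otimes\overset{n\text{th}}{x}\otimes I\otimes\cdots$ is $\mathrm{Tr}(\rho^{(n)}x)$. -/

import Mathlib

open scoped ComplexOrder InnerProductSpace
open Filter Topology

noncomputable section

/-! ## Strong limits, trace, density operators -/

section Operators

variable {h : Type*} [NormedAddCommGroup h] [InnerProductSpace ℂ h] [CompleteSpace h]

/-- The limit of a sequence of bounded operators in the strong operator topology
(and `0` if there is none). -/
def strongLim (u : ℕ → h →L[ℂ] h) : h →L[ℂ] h :=
  open Classical in
  if H : ∃ T : h →L[ℂ] h, ∀ v, Tendsto (fun n => u n v) atTop (𝓝 (T v)) then H.choose else 0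

/-- The sum of a family of bounded operators that is (unconditionally) summable in the strong
operator topology (and `0` if the family is not summable). -/
def strongSum {ι : Type*} (u : ι → h →L[ℂ] h) : h →L[ℂ] h :=
  open Classical in
  if H : ∃ T : h →L[ℂ] h, ∀ v, HasSum (fun i => u i v) (T v) then H.choose else 0

variable (h) in
/-- The index set of a fixed Hilbert basis of `h`. -/
def basisIndex : Set h := (exists_hilbertBasis ℂ h).choose

variable (h) in
/-- A fixed Hilbert basis of `h`, used to compute traces. -/
def stdBasis : HilbertBasis (basisIndex h) ℂ h := (exists_hilbertBasis ℂ h).choose_spec.choose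

/-- `T` is of trace class: `∑ₖ ⟪eₖ, |T| eₖ⟫ < ∞`. -/
def IsTraceClass (T : h →L[ℂ] h) : Prop :=
  Summable fun k => (⟪stdBasis h k, CFC.abs T (stdBasis h k)⟫_ℂ).re

/-- The trace `∑ₖ ⟪eₖ, T eₖ⟫` (meant for trace class operators). -/
def opTrace (T : h →L[ℂ] h) : ℂ := ∑' k, ⟪stdBasis h k, T (stdBasis h k)⟫_ℂ

/-- Density operators: positive trace class operators of trace one. -/
structure IsDensity (ρ : h →L[ℂ] h) : Prop where
  nonneg : 0 ≤ ρ
  traceClass : IsTraceClass ρ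
  trace_eq_one : opTrace ρ = 1

/-- `φ` restricts to a state on the unital `*`-algebra `A` (its values off `A` are irrelevant). -/
structure IsStateOn (A : StarSubalgebra ℂ (h →L[ℂ] h)) (φ : (h →L[ℂ] h) → ℂ) : Prop where
  map_add : ∀ a ∈ A, ∀ b ∈ A, φ (a + b) = φ a + φ b
  map_smul : ∀ c : ℂ, ∀ a ∈ A, φ (c • a) = c * φ a
  nonneg : ∀ a ∈ A, 0 ≤ φ (star a * a)
  map_one : φ 1 = 1

/-- The von Neumann algebra generated by a set of operators: its double commutant. -/
def generatedVN (S : Set (h →L[ℂ] h)) : VonNeumannAlgebra h where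
  toStarSubalgebra :=
    StarSubalgebra.centralizer ℂ (StarSubalgebra.centralizer ℂ S : Set (h →L[ℂ] h))
  centralizer_centralizer' := by
    change Set.centralizer (Set.centralizer (↑(StarSubalgebra.centralizer ℂ
      (StarSubalgebra.centralizer ℂ S : Set (h →L[ℂ] h))) : Set (h →L[ℂ] h))) =
      ↑(StarSubalgebra.centralizer ℂ (StarSubalgebra.centralizer ℂ S : Set (h →L[ℂ] h)))
    simp only [StarSubalgebra.coe_centralizer_centralizer, Set.centralizer_centralizer_centralizer]

end Operators

/-! ## The infinite tensor product -/

section InfiniteTensor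

variable (h : Type*) [NormedAddCommGroup h] [InnerProductSpace ℂ h]

/-- Sequences of vectors that are eventually of norm one. -/
structure TensorSeq where
  /-- the entries -/
  seq : ℕ → h
  norm_eq_one : ∀ᶠ n in atTop, ‖seq n‖ = 1

/-- Formal linear combinations of product vectors `f₀ ⊗ f₁ ⊗ ⋯`. -/
abbrev PreTensor : Type _ := TensorSeq h →₀ ℂ

variable {h}

/-- The tail relation: two sequences agree from some place on. -/
def TensorSeq.setoid : Setoid (TensorSeq h) where
  r f g := ∀ᶠ n in atTop, f.1 n = g.1 n
  iseqv :=
    ⟨fun _ => Eventually.of_forall fun _ => rfl, fun H => H.mono fun _ e => e.symm,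
      fun H H' => (H.and H').mono fun _ e => e.1.trans e.2⟩

/-- The inner product of `f₀ ⊗ f₁ ⊗ ⋯` and `g₀ ⊗ g₁ ⊗ ⋯`: it is `∏ₙ ⟪fₙ, gₙ⟫` if the sequences
agree from some place on (then all but finitely many factors are `1`), and `0` otherwise. -/
def tensorKernel (f g : TensorSeq h) : ℂ :=
  open Classical in
  if ∀ᶠ n in atTop, f.1 n = g.1 n then ∏ᶠ n, ⟪f.1 n, g.1 n⟫_ℂ else 0

/-- `f` with its `n`-th entry `fₙ` replaced by `a fₙ`. -/
def TensorSeq.act (n : ℕ) (a : h →L[ℂ] h) (f : TensorSeq h) : TensorSeq h :=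
  ⟨Function.update f.1 n (a (f.1 n)), by
    filter_upwards [f.2, eventually_ne_atTop n] with m hm hne
    rwa [Function.update_of_ne hne]⟩

theorem posSemidef_of_eventually {X : Type*} {A : ℕ → Matrix X X ℂ} {K : Matrix X X ℂ}
    (hA : ∀ᶠ N in atTop, (A N).PosSemidef) (hK : ∀ f g, ∀ᶠ N in atTop, A N f g = K f g) :
    K.PosSemidef := by
  refine ⟨?_, fun x => ?_⟩
  · ext f g
    obtain ⟨N, hN, h1, h2⟩ := (hA.and ((hK f g).and (hK g f))).exists
    rw [Matrix.conjTranspose_apply, ← h1, ← h2]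
    exact hN.1.apply f g
  · have : ∀ᶠ N in atTop, ∀ f ∈ x.support, ∀ g ∈ x.support, A N f g = K f g := by
      rw [Filter.eventually_all_finset]
      intro f _
      rw [Filter.eventually_all_finset]
      intro g _
      exact hK f g
    obtain ⟨N, hN, h1⟩ := (hA.and this).exists
    refine (hN.2 x).trans_eq ?_
    refine Finset.sum_congr rfl fun f hf => Finset.sum_congr rfl fun g hg => ?_
    simp only [h1 f hf g hg]

theorem gram_posSemidef {X E : Type*} [NormedAddCommGroup E] [InnerProductSpace ℂ E] (v : X → E) :
    (Matrix.gram ℂ v).PosSemidef := by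
  refine ⟨Matrix.isHermitian_gram ℂ v, fun c => ?_⟩
  have : (c.sum fun i ci => c.sum fun j cj => star ci * Matrix.gram ℂ v i j * cj) =
      ⟪∑ i ∈ c.support, c i • v i, ∑ i ∈ c.support, c i • v i⟫_ℂ := by
    rw [sum_inner]
    refine Finset.sum_congr rfl fun i _ => ?_
    rw [inner_sum]
    refine Finset.sum_congr rfl fun j _ => ?_
    simp only [inner_smul_left, inner_smul_right, Matrix.gram_apply, starRingEnd_apply]
    ring
  rw [this, inner_self_eq_norm_sq_to_K (𝕜 := ℂ)]
  positivity

/-- The `0`-`1` matrix of the tail relation. -/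
def tailMatrix (f g : TensorSeq h) : ℂ :=
  open Classical in if ∀ᶠ n in atTop, f.1 n = g.1 n then 1 else 0

set_option linter.unusedSectionVars false in
theorem tailMatrix_posSemidef : (Matrix.of (tailMatrix (h := h))).PosSemidef := by
  classical
  have := gram_posSemidef
    (fun f : TensorSeq h =>
      lp.single (E := fun _ : Quotient (TensorSeq.setoid (h := h)) => ℂ) 2
        (Quotient.mk TensorSeq.setoid f) (1 : ℂ))
  convert this using 1
  refine Matrix.ext fun f g => ?_
  have hfg : (Quotient.mk TensorSeq.setoid f = Quotient.mk TensorSeq.setoid g) ↔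
      ∀ᶠ n in atTop, f.1 n = g.1 n := Quotient.eq
  rw [Matrix.of_apply, Matrix.gram_apply, lp.inner_single_left, lp.single_apply, tailMatrix]
  by_cases H : ∀ᶠ n in atTop, f.1 n = g.1 n
  · rw [if_pos H, hfg.2 H]
    simp
  · rw [if_neg H, Pi.single_eq_of_ne (fun e => H (hfg.1 e))]
    simp

theorem finProd_posSemidef (s : Finset ℕ) :
    (Matrix.of fun f g : TensorSeq h => ∏ m ∈ s, ⟪f.1 m, g.1 m⟫_ℂ).PosSemidef := by
  classical
  induction s using Finset.induction_on with
  | empty =>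
    have := gram_posSemidef (fun _ : TensorSeq h => (1 : ℂ))
    convert! this using 1
    refine Matrix.ext fun f g => ?_
    simp [Matrix.gram_apply]
  | insert k s hk ih =>
    have := (gram_posSemidef (fun f : TensorSeq h => f.1 k)).hadamard ih
    convert! this using 1
    refine Matrix.ext fun f g => ?_
    simp [Matrix.hadamard_apply, Matrix.gram_apply, Finset.prod_insert hk]

theorem tensorKernel_eventually (f g : TensorSeq h) : ∀ᶠ N in atTop,
    tailMatrix f g * ∏ m ∈ Finset.range N, ⟪f.1 m, g.1 m⟫_ℂ = tensorKernel f g := by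
  classical
  by_cases H : ∀ᶠ n in atTop, f.1 n = g.1 n
  · obtain ⟨M, hM⟩ := eventually_atTop.1 (H.and f.2)
    filter_upwards [eventually_ge_atTop M] with N hN
    rw [tailMatrix, tensorKernel, if_pos H, if_pos H, one_mul]
    symm
    apply finprod_eq_prod_of_mulSupport_subset
    intro m hm
    by_contra hmN
    simp only [Finset.coe_range, Set.mem_Iio, not_lt] at hmN
    obtain ⟨h1, h2⟩ := hM m (hN.trans hmN)
    apply hm
    simp only [← h1]
    rw [inner_self_eq_norm_sq_to_K, h2]
    simp
  · exact Eventually.of_forall fun N => by rw [tailMatrix, tensorKernel, if_neg H, if_neg H, zero_mul]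

theorem tensorKernel_posSemidef : (Matrix.of (tensorKernel (h := h))).PosSemidef :=
  posSemidef_of_eventually
    (A := fun N => Matrix.hadamard (Matrix.of tailMatrix)
      (Matrix.of fun f g : TensorSeq h => ∏ m ∈ Finset.range N, ⟪f.1 m, g.1 m⟫_ℂ))
    (Eventually.of_forall fun _ => tailMatrix_posSemidef.hadamard (finProd_posSemidef _))
    tensorKernel_eventually

theorem tailMatrix_act (n : ℕ) (a : h →L[ℂ] h) (f g : TensorSeq h) :
    tailMatrix (f.act n a) (g.act n a) = tailMatrix f g := by
  have : (∀ᶠ m in atTop, (f.act n a).1 m = (g.act n a).1 m) ↔ ∀ᶠ m in atTop, f.1 m = g.1 m := by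
    apply eventually_congr
    filter_upwards [eventually_ne_atTop n] with m hm
    simp [TensorSeq.act, Function.update_of_ne hm]
  classical
  simp only [tailMatrix]
  exact if_congr this rfl rfl

theorem tensorKernel_act_posSemidef (n : ℕ) (a : h →L[ℂ] h) :
    (Matrix.of fun f g : TensorSeq h => (‖a‖ ^ 2 : ℝ) • tensorKernel f g -
      tensorKernel (f.act n a) (g.act n a)).PosSemidef := by
  classical
  refine posSemidef_of_eventually
    (A := fun N => Matrix.hadamard (Matrix.hadamard (Matrix.of tailMatrix)
      (Matrix.of fun f g : TensorSeq h => ∏ m ∈ (Finset.range N).erase n, ⟪f.1 m, g.1 m⟫_ℂ))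
      (‖a‖ ^ 2 • Matrix.gram ℂ (fun f : TensorSeq h => f.1 n) -
        Matrix.gram ℂ (a ∘ fun f : TensorSeq h => f.1 n)))
    (Eventually.of_forall fun _ => (tailMatrix_posSemidef.hadamard (finProd_posSemidef _)).hadamard
      (Matrix.posSemidef_opNorm_smul_gram_sub_gram _ a)) fun f g => ?_
  filter_upwards [eventually_gt_atTop n, tensorKernel_eventually f g,
    tensorKernel_eventually (f.act n a) (g.act n a)] with N hN h1 h2
  have hmem : n ∈ Finset.range N := Finset.mem_range.2 hN
  have h3 : ∏ m ∈ (Finset.range N).erase n, ⟪(f.act n a).1 m, (g.act n a).1 m⟫_ℂ =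
      ∏ m ∈ (Finset.range N).erase n, ⟪f.1 m, g.1 m⟫_ℂ := by
    refine Finset.prod_congr rfl fun m hm => ?_
    simp [TensorSeq.act, Function.update_of_ne (Finset.ne_of_mem_erase hm)]
  rw [Matrix.of_apply, ← h1, ← h2, tailMatrix_act, ← Finset.mul_prod_erase _ _ hmem,
    ← Finset.mul_prod_erase _ (fun m => ⟪(f.act n a).1 m, (g.act n a).1 m⟫_ℂ) hmem, h3]
  simp only [Matrix.hadamard_apply, Matrix.of_apply, Matrix.sub_apply, Matrix.smul_apply, Matrix.gram_apply,
    TensorSeq.act, Function.update_self, Function.comp_apply, Complex.real_smul]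
  ring

instance : PreInnerProductSpace.Core ℂ (PreTensor h) where
  inner x y := Finsupp.sum (M := ℂ) x fun f c => Finsupp.sum (M := ℂ) y fun g d =>
    star c * tensorKernel f g * d
  conj_inner_symm x y := by
    rw [Finsupp.sum_comm]
    simp only [map_finsuppSum]
    refine Finset.sum_congr rfl fun f _ => Finset.sum_congr rfl fun g _ => ?_
    have := tensorKernel_posSemidef.isHermitian.apply f g
    simp only [Matrix.of_apply] at this
    beta_reduce
    rw [← this]
    simp
    ring
  add_left x y z := by
    rw [Finsupp.sum_add_index'] <;> simp [← Finsupp.sum_add, add_mul]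
  smul_left x y c := by
    rw [Finsupp.sum_smul_index] <;> simp [Finsupp.mul_sum, ← mul_assoc]
  re_inner_nonneg x := (Complex.le_def.1 (tensorKernel_posSemidef.2 x)).1

instance : SeminormedAddCommGroup (PreTensor h) :=
  InnerProductSpace.Core.toSeminormedAddCommGroup (𝕜 := ℂ)

instance : InnerProductSpace ℂ (PreTensor h) := .ofCore _

theorem PreTensor.inner_def (x y : PreTensor h) : ⟪x, y⟫_ℂ =
    Finsupp.sum (M := ℂ) x fun f c => Finsupp.sum (M := ℂ) y fun g d =>
      star c * tensorKernel f g * d := rfl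

/-- The linear map `f₀ ⊗ f₁ ⊗ ⋯ ↦ f₀ ⊗ ⋯ ⊗ a fₙ ⊗ ⋯` on formal linear combinations. -/
def PreTensor.legₗ (n : ℕ) (a : h →L[ℂ] h) : PreTensor h →ₗ[ℂ] PreTensor h :=
  Finsupp.lmapDomain ℂ ℂ (TensorSeq.act n a)

theorem PreTensor.norm_legₗ_le (n : ℕ) (a : h →L[ℂ] h) (x : PreTensor h) :
    ‖PreTensor.legₗ n a x‖ ≤ ‖a‖ * ‖x‖ := by
  rw [← sq_le_sq₀ (norm_nonneg _) (by positivity), mul_pow,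
    ← inner_self_eq_norm_sq (𝕜 := ℂ) (PreTensor.legₗ n a x), ← inner_self_eq_norm_sq (𝕜 := ℂ) x]
  have := (Complex.le_def.1 ((tensorKernel_act_posSemidef n a).2 x)).1
  have h1 : ⟪PreTensor.legₗ n a x, PreTensor.legₗ n a x⟫_ℂ = Finsupp.sum (M := ℂ) x fun f c =>
      Finsupp.sum (M := ℂ) x fun g d =>
        star c * tensorKernel (f.act n a) (g.act n a) * d := by
    rw [PreTensor.inner_def]
    simp only [PreTensor.legₗ, Finsupp.lmapDomain_apply]
    rw [Finsupp.sum_mapDomain_index]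
    · congr! 3 with f c
      rw [Finsupp.sum_mapDomain_index] <;> simp [mul_add]
    · simp
    · intro f c d
      simp [← Finsupp.sum_add, add_mul]
  have h2 : ((‖a‖ ^ 2 : ℝ) : ℂ) * ⟪x, x⟫_ℂ - ⟪PreTensor.legₗ n a x, PreTensor.legₗ n a x⟫_ℂ =
      Finsupp.sum (M := ℂ) x fun f c => Finsupp.sum (M := ℂ) x fun g d =>
        star c * ((‖a‖ ^ 2 : ℝ) • tensorKernel f g -
          tensorKernel (f.act n a) (g.act n a)) * d := by
    rw [h1, PreTensor.inner_def]
    simp only [Finsupp.sum, Finset.mul_sum, ← Finset.sum_sub_distrib, Complex.real_smul]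
    refine Finset.sum_congr rfl fun f _ => Finset.sum_congr rfl fun g _ => ?_
    ring
  change 0 ≤ (Finsupp.sum (M := ℂ) x fun f c => Finsupp.sum (M := ℂ) x fun g d =>
        star c * ((‖a‖ ^ 2 : ℝ) • tensorKernel f g -
          tensorKernel (f.act n a) (g.act n a)) * d).re at this
  rw [← h2, Complex.sub_re, Complex.re_ofReal_mul] at this
  exact sub_nonneg.1 this

variable (h) in
/-- The infinite tensor product `h ⊗ h ⊗ ⋯` of Hilbert spaces: the Hilbert space generated by the
product vectors. Each class of eventually equal sequences spans an (incomplete) infinite tensor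
product in the sense of von Neumann along that class; the orthogonal sum over the classes avoids
the choice of a reference vector. -/
def InfTensor : Type _ := UniformSpace.Completion (PreTensor h)

instance : NormedAddCommGroup (InfTensor h) :=
  inferInstanceAs (NormedAddCommGroup (UniformSpace.Completion (PreTensor h)))
instance : InnerProductSpace ℂ (InfTensor h) :=
  inferInstanceAs (InnerProductSpace ℂ (UniformSpace.Completion (PreTensor h)))
instance : CompleteSpace (InfTensor h) :=
  inferInstanceAs (CompleteSpace (UniformSpace.Completion (PreTensor h)))

/-- The embedding of formal linear combinations of product vectors. -/
def PreTensor.toInf : PreTensor h →L[ℂ] InfTensor h :=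
  (UniformSpace.Completion.toComplL : PreTensor h →L[ℂ] UniformSpace.Completion (PreTensor h))

/-- The product vector `f₀ ⊗ f₁ ⊗ ⋯`. -/
def productVec (f : TensorSeq h) : InfTensor h := PreTensor.toInf (Finsupp.single f (1 : ℂ))

/-- The operator `Jₙ(a) = I ⊗ ⋯ ⊗ I ⊗ a ⊗ I ⊗ ⋯`, with `a` in the `n`-th slot. -/
def leg (n : ℕ) (a : h →L[ℂ] h) : InfTensor h →L[ℂ] InfTensor h :=
  (PreTensor.toInf ∘L
    (PreTensor.legₗ n a).mkContinuous ‖a‖ (PreTensor.norm_legₗ_le n a)).extend PreTensor.toInf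

theorem inner_productVec (f g : TensorSeq h) :
    ⟪productVec f, productVec g⟫_ℂ = tensorKernel f g := by
  refine (UniformSpace.Completion.inner_coe _ _).trans ?_
  rw [PreTensor.inner_def, Finsupp.sum_single_index, Finsupp.sum_single_index] <;> simp

theorem leg_productVec (n : ℕ) (a : h →L[ℂ] h) (f : TensorSeq h) :
    leg n a (productVec f) = productVec (f.act n a) := by
  refine (ContinuousLinearMap.extend_eq _ UniformSpace.Completion.denseRange_coe
    (UniformSpace.Completion.isUniformInducing_coe _) _).trans ?_
  change PreTensor.toInf (PreTensor.legₗ n a (Finsupp.single f (1 : ℂ))) = _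
  rw [PreTensor.legₗ, Finsupp.lmapDomain_apply, Finsupp.mapDomain_single]
  rfl

variable [CompleteSpace h]

/-- `a₀ ⊗ a₁ ⊗ ⋯ ⊗ aₙ ⊗ I ⊗ I ⊗ ⋯ = J₀(a₀) J₁(a₁) ⋯ Jₙ(aₙ)`. -/
def localProduct (a : ℕ → h →L[ℂ] h) (n : ℕ) : InfTensor h →L[ℂ] InfTensor h :=
  ((List.range (n + 1)).map fun k => leg k (a k)).prod

/-- The tensor product `𝓑 ⊗ ⋯ ⊗ 𝓑` (`n + 1` factors) of von Neumann algebras, as the von Neumann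
algebra on the infinite tensor product generated by the slots `0, …, n`. -/
def localAlgebra (𝓑 : VonNeumannAlgebra h) (n : ℕ) : VonNeumannAlgebra (InfTensor h) :=
  generatedVN {T | ∃ k ≤ n, ∃ a ∈ 𝓑, T = leg k a}

/-- The infinite tensor product `𝓐 = 𝓑 ⊗ 𝓑 ⊗ ⋯`: the norm closure of the union of the increasing
sequence of the finite tensor products (quasi-local algebra). -/
def infTensorAlgebra (𝓑 : VonNeumannAlgebra h) :
    StarSubalgebra ℂ (InfTensor h →L[ℂ] InfTensor h) :=
  (⨆ n, (localAlgebra 𝓑 n).toStarSubalgebra).topologicalClosure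

/-- A functional on `𝓐` is locally normal if on each finite tensor product it is of the form
`T ↦ ∑ₖ ⟪ξₖ, T ξₖ⟫` with `∑ₖ ‖ξₖ‖² < ∞`. -/
def IsLocallyNormal (𝓑 : VonNeumannAlgebra h)
    (φ : (InfTensor h →L[ℂ] InfTensor h) → ℂ) : Prop :=
  ∀ n, ∃ ξ : ℕ → InfTensor h, Summable (fun k => ‖ξ k‖ ^ 2) ∧
    ∀ T ∈ localAlgebra 𝓑 n, HasSum (fun k => ⟪ξ k, T (ξ k)⟫_ℂ) (φ T)

end InfiniteTensor

/-! ## Quantum Markov chains -/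

section QMC

variable {h : Type*} [NormedAddCommGroup h] [InnerProductSpace ℂ h] [CompleteSpace h]

/-- A transition expectation `E : 𝓑 ⊗ 𝓑 → 𝓑`, written as `E x y` for `E (x ⊗ y)`: bilinear,
completely positive and sub-Markovian, `E (I ⊗ I) ≤ I`. -/
structure IsTransitionExpectation (𝓑 : VonNeumannAlgebra h)
    (E : (h →L[ℂ] h) → (h →L[ℂ] h) → (h →L[ℂ] h)) : Prop where
  mem : ∀ x ∈ 𝓑, ∀ y ∈ 𝓑, E x y ∈ 𝓑
  add_left : ∀ x ∈ 𝓑, ∀ x' ∈ 𝓑, ∀ y ∈ 𝓑, E (x + x') y = E x y + E x' y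
  smul_left : ∀ c : ℂ, ∀ x ∈ 𝓑, ∀ y ∈ 𝓑, E (c • x) y = c • E x y
  add_right : ∀ x ∈ 𝓑, ∀ y ∈ 𝓑, ∀ y' ∈ 𝓑, E x (y + y') = E x y + E x y'
  smul_right : ∀ c : ℂ, ∀ x ∈ 𝓑, ∀ y ∈ 𝓑, E x (c • y) = c • E x y
  /-- `∑ c_p* E(z_p* z_q) c_q ≥ 0`; by bilinearity elementary tensors `z_p = x_p ⊗ y_p` suffice. -/
  completely_positive : ∀ (N : ℕ) (x y c : Fin N → h →L[ℂ] h),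
    (∀ p, x p ∈ 𝓑) → (∀ p, y p ∈ 𝓑) → (∀ p, c p ∈ 𝓑) →
      0 ≤ ∑ p, ∑ q, star (c p) * E (star (x p) * x q) (star (y p) * y q) * c q
  subMarkovian : E 1 1 ≤ 1

/-- `𝓔⁽ⁿ⁾(I ⊗ 𝓔⁽ⁿ⁺¹⁾(I ⊗ ⋯ ⊗ 𝓔⁽ⁿ⁺ᵏ⁾(I ⊗ I)))`. -/
def nestedUnit (E : ℕ → (h →L[ℂ] h) → (h →L[ℂ] h) → (h →L[ℂ] h)) : ℕ → ℕ → (h →L[ℂ] h)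
  | 0, n => E n 1 1
  | k + 1, n => E n 1 (nestedUnit E k (n + 1))

/-- `b̄(n) = limₖ 𝓔⁽ⁿ⁾(I ⊗ 𝓔⁽ⁿ⁺¹⁾(I ⊗ ⋯ ⊗ 𝓔⁽ⁿ⁺ᵏ⁾(I ⊗ I)))`, a strong limit. -/
def bBar (E : ℕ → (h →L[ℂ] h) → (h →L[ℂ] h) → (h →L[ℂ] h)) (n : ℕ) : h →L[ℂ] h :=
  strongLim fun k => nestedUnit E k n

/-- `𝓔⁽ᵐ⁾(aₘ ⊗ 𝓔⁽ᵐ⁺¹⁾(aₘ₊₁ ⊗ ⋯ ⊗ 𝓔⁽ᵐ⁺ᵏ⁾(aₘ₊ₖ ⊗ b̄(m+k+1))))`. -/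
def nestedExp (E : ℕ → (h →L[ℂ] h) → (h →L[ℂ] h) → (h →L[ℂ] h)) (a : ℕ → h →L[ℂ] h) :
    ℕ → ℕ → (h →L[ℂ] h)
  | 0, m => E m (a m) (bBar E (m + 1))
  | k + 1, m => E m (a m) (nestedExp E a k (m + 1))

/-- `E_{0]}(a₀ ⊗ ⋯ ⊗ aₙ ⊗ I ⊗ ⋯)`. -/
def condExpLocal (E : ℕ → (h →L[ℂ] h) → (h →L[ℂ] h) → (h →L[ℂ] h)) (a : ℕ → h →L[ℂ] h)
    (n : ℕ) : h →L[ℂ] h :=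
  nestedExp E a n 0

/-- `E_{0]}(a₀ ⊗ a₁ ⊗ ⋯) = limₙ E_{0]}(a₀ ⊗ ⋯ ⊗ aₙ ⊗ I ⊗ ⋯)`, a strong limit. -/
def condExp₀ (E : ℕ → (h →L[ℂ] h) → (h →L[ℂ] h) → (h →L[ℂ] h)) (a : ℕ → h →L[ℂ] h) :
    h →L[ℂ] h :=
  strongLim fun n => condExpLocal E a n

/-- The value `φ₀(E_{0]}(a))` at `a = a₀ ⊗ a₁ ⊗ ⋯` of the functional defined by `φ₀` and `E`. -/
def qmcValue (φ₀ : (h →L[ℂ] h) → ℂ) (E : ℕ → (h →L[ℂ] h) → (h →L[ℂ] h) → (h →L[ℂ] h))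
    (a : ℕ → h →L[ℂ] h) : ℂ :=
  φ₀ (condExp₀ E a)

/-- `φ` is a state on the infinite tensor product `𝓐` that is given by `φ₀ ∘ E_{0]}` on the
elements `a₀ ⊗ ⋯ ⊗ aₙ ⊗ I ⊗ ⋯`. -/
structure IsQMCState (𝓑 : VonNeumannAlgebra h) (φ₀ : (h →L[ℂ] h) → ℂ)
    (E : ℕ → (h →L[ℂ] h) → (h →L[ℂ] h) → (h →L[ℂ] h))
    (φ : (InfTensor h →L[ℂ] InfTensor h) → ℂ) : Prop where
  state : IsStateOn (infTensorAlgebra 𝓑) φ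
  apply_localProduct : ∀ a : ℕ → h →L[ℂ] h, (∀ k, a k ∈ 𝓑) → ∀ n,
    φ (localProduct a n) = φ₀ (condExpLocal E a n)

/-- Markov pairs `(φ₀, (𝓔⁽ⁿ⁾)ₙ)`: a state on `𝓑` and a sequence of transition expectations, such
that `φ₀ ∘ E_{0]}` takes the value `1` at `I ⊗ I ⊗ ⋯` and defines a state on `𝓐`. -/
structure IsMarkovPair (𝓑 : VonNeumannAlgebra h) (φ₀ : (h →L[ℂ] h) → ℂ)
    (E : ℕ → (h →L[ℂ] h) → (h →L[ℂ] h) → (h →L[ℂ] h)) : Prop where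
  initial : IsStateOn 𝓑.toStarSubalgebra φ₀
  transition : ∀ n, IsTransitionExpectation 𝓑 (E n)
  markovian : qmcValue φ₀ E (fun _ => 1) = 1
  exists_state : ∃ φ, IsQMCState 𝓑 φ₀ E φ

end QMC

/-! ## Open quantum random walks -/

section OQRW

variable {Λ H : Type*} [DecidableEq Λ] [NormedAddCommGroup H] [InnerProductSpace ℂ H]

variable (Λ H) in
/-- `𝓗 ⊗ 𝓚`, where `𝓚` has the orthonormal basis `|i⟩`, `i ∈ Λ`: the space `ℓ²(Λ; 𝓗)`, with
`v ⊗ |i⟩` corresponding to `lp.single 2 i v`. -/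
abbrev WalkSpace : Type _ := lp (fun _ : Λ => H) 2

/-- `a ⊗ |i⟩⟨j|`. -/
def site (a : H →L[ℂ] H) (i j : Λ) : WalkSpace Λ H →L[ℂ] WalkSpace Λ H :=
  lp.singleContinuousLinearMap ℂ (fun _ : Λ => H) 2 i ∘L a ∘L lp.evalCLM ℂ (fun _ : Λ => H) 2 j

/-- The diagonal block `T_j` of an operator `T` on `𝓗 ⊗ 𝓚`, so that `T_j = ρ_j` for
`T = ∑ᵢ ρᵢ ⊗ |i⟩⟨i|`. -/
def block (T : WalkSpace Λ H →L[ℂ] WalkSpace Λ H) (j : Λ) : H →L[ℂ] H :=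
  lp.evalCLM ℂ (fun _ : Λ => H) 2 j ∘L T ∘L lp.singleContinuousLinearMap ℂ (fun _ : Λ => H) 2 j

/-- The block-diagonal operator `∑ᵢ rᵢ ⊗ |i⟩⟨i|` (a norm convergent sum). -/
def diagOp (r : Λ → H →L[ℂ] H) : WalkSpace Λ H →L[ℂ] WalkSpace Λ H :=
  ∑' i, site (r i) i i

variable [CompleteSpace H]

variable (Λ H) in
/-- The von Neumann algebra `𝓑` on `𝓗 ⊗ 𝓚` generated by the operators `∑ᵢ a(i) ⊗ |i⟩⟨i|` with
`∑ᵢ ‖a(i)‖ < ∞`. -/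
def blockAlgebra : VonNeumannAlgebra (WalkSpace Λ H) :=
  generatedVN {T | ∃ a : Λ → H →L[ℂ] H, Summable (fun i => ‖a i‖) ∧ T = diagOp a}

/-- `𝓜(ρ) = ∑_{i,j} M^i_j ρ (M^i_j)*` with `M^i_j = B^i_j ⊗ |i⟩⟨j|`. Here and below `B i j` stands
for `B^i_j`, the effect of passing from `j` to `i`. -/
def walkMap (B : Λ → Λ → H →L[ℂ] H) (ρ : WalkSpace Λ H →L[ℂ] WalkSpace Λ H) :
    WalkSpace Λ H →L[ℂ] WalkSpace Λ H :=
  ∑' p : Λ × Λ, site (B p.1 p.2) p.1 p.2 * ρ * star (site (B p.1 p.2) p.1 p.2)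

/-- `ρ⁽ⁿ⁾ = 𝓜ⁿ(ρ⁽⁰⁾)` with `ρ⁽⁰⁾ = ∑ᵢ rᵢ ⊗ |i⟩⟨i|`. -/
def walkState (B : Λ → Λ → H →L[ℂ] H) (r : Λ → H →L[ℂ] H) (n : ℕ) :
    WalkSpace Λ H →L[ℂ] WalkSpace Λ H :=
  (walkMap B)^[n] (diagOp r)

/-- `𝓔⁽ⁿ⁾(x ⊗ y) = ∑_{j : ρ⁽ⁿ⁾_j ≠ 0} ∑ᵢ Tr((ρ⁽ⁿ⁾_j ⊗ |j⟩⟨j|) x) / Tr(ρ⁽ⁿ⁾_j) (M^i_j)* y M^i_j`,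
a strongly convergent sum. -/
def walkTransition (B : Λ → Λ → H →L[ℂ] H) (r : Λ → H →L[ℂ] H) (n : ℕ)
    (x y : WalkSpace Λ H →L[ℂ] WalkSpace Λ H) : WalkSpace Λ H →L[ℂ] WalkSpace Λ H :=
  strongSum fun p : {j : Λ // block (walkState B r n) j ≠ 0} × Λ =>
    (opTrace (site (block (walkState B r n) p.1) p.1.1 p.1.1 * x) /
        opTrace (block (walkState B r n) p.1)) •
      (star (site (B p.2 p.1) p.2 p.1.1) * y * site (B p.2 p.1) p.2 p.1.1)

/-- The functional `x ↦ Tr(ρ x)`. -/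
def traceFunctional {h : Type*} [NormedAddCommGroup h] [InnerProductSpace ℂ h] [CompleteSpace h]
    (ρ : h →L[ℂ] h) : (h →L[ℂ] h) → ℂ :=
  fun x => opTrace (ρ * x)

end OQRW

end

/-! The value of the chain on `a₀ ⊗ ⋯ ⊗ aₙ` is a mixture of product vector states. Write `ρ⁽⁰⁾ = ∑
|u_α⟩⟨u_α|`, and at each time and site write the normalised block as `∑ |η_α⟩⟨η_α|`. Then `𝓔⁽ⁿ⁾(x ⊗
y) = ∑ₚ cₚ(x) Nₚ* y Nₚ`, where `Nₚ` runs through the `M^i_j` and `cₚ(x) = ∑ ⟪η_α, x η_α⟫` depends on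
the source site only. Iteration turns `Tr(ρ⁽⁰⁾ E_{0]}(·))` into a sum over paths: a path carries the
tensor `ζ = η₀ ⊗ ⋯ ⊗ ηₙ ⊗ Ω ⊗ Ω ⊗ ⋯` and the vector obtained from some `u_α` by applying the `Nₚ`,
and contributes `⟪ζ, T ζ⟫` times the squared norm of that vector. Positivity and local normality are
then evident (`pathSum_succ`, `trace_nestedExp`).

The delicate point is that `𝓔⁽ⁿ⁾(I ⊗ I)` may be strictly below `I` when blocks vanish, so that
consistency in `n` and the removal of `b̄(n)` need an argument. The duality `Tr(ρ⁽ⁿ⁺¹⁾ y) = Tr(ρ⁽ⁿ⁾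
𝓔⁽ⁿ⁾(I ⊗ y))` shows that the nested units, although only `≤ I`, have trace one against `ρ⁽ⁿ⁾`. A
positive operator of zero expectation annihilates the vectors of the mixture; hence nested units,
and their limit `b̄(n)`, fix every path vector of nonzero weight (`apply_pathVec_eq_self`).

The path sums are therefore constant from some `n` on along each local algebra. They are bounded by
`‖T‖`, so a limit along an ultrafilter defines the state at once on all bounded operators. The
marginals come from `Tr(ρ⁽ⁿ⁾ 𝓔⁽ⁿ⁾(x ⊗ I)) = Tr(ρ⁽ⁿ⁾ x)`, which holds because elements of `𝓑` commute
with the projections `I ⊗ |j⟩⟨j|` (`opTrace_walkTransition_one`). -/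

section HilbertSpace

variable {E F : Type*} [NormedAddCommGroup E] [InnerProductSpace ℂ E]
  [NormedAddCommGroup F] [InnerProductSpace ℂ F]

/-! ### Positivity and strong sums -/

theorem ContinuousLinearMap.nonneg_iff_inner {T : E →L[ℂ] E} :
    0 ≤ T ↔ ∀ v, 0 ≤ ⟪v, T v⟫_ℂ := by
  rw [ContinuousLinearMap.nonneg_iff_isPositive]
  refine ⟨fun h v => h.inner_nonneg_right v, fun h => ?_⟩
  rw [ContinuousLinearMap.isPositive_iff_complex]
  intro v
  have h1 := Complex.nonneg_iff.1 (h v)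
  have h2 : ⟪T v, v⟫_ℂ = ⟪v, T v⟫_ℂ := by
    rw [← inner_conj_symm, Complex.conj_eq_iff_im.2 h1.2.symm]
  rw [h2]
  refine ⟨Complex.ext (by simp) (by simpa using h1.2), h1.1⟩

theorem ContinuousLinearMap.le_iff_inner [CompleteSpace E] {S T : E →L[ℂ] E} :
    S ≤ T ↔ ∀ v, ⟪v, S v⟫_ℂ ≤ ⟪v, T v⟫_ℂ := by
  rw [← sub_nonneg, ContinuousLinearMap.nonneg_iff_inner]
  simp only [sub_apply, inner_sub_right, sub_nonneg]

/-- With `s = √T`, `‖s (s v)‖ ≤ ‖s‖ ‖s v‖`, while `‖s‖² = ‖T‖` and `‖s v‖² = ⟪v, T v⟫`. This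
upgrades convergence or vanishing of quadratic forms to the strong topology. -/
theorem norm_sq_apply_le_of_nonneg [CompleteSpace E] {T : E →L[ℂ] E} (hT : 0 ≤ T) (v : E) :
    ‖T v‖ ^ 2 ≤ ‖T‖ * (⟪v, T v⟫_ℂ).re := by
  set s := CFC.sqrt T
  have hs : s * s = T := CFC.sqrt_mul_sqrt_self T hT
  have hsa : IsSelfAdjoint s := (CFC.sqrt_nonneg T).isSelfAdjoint
  have hadj : ContinuousLinearMap.adjoint s = s := hsa
  have h1 : (⟪v, T v⟫_ℂ).re = ‖s v‖ ^ 2 := by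
    rw [← hs, mul_apply_eq_comp, ← ContinuousLinearMap.adjoint_inner_left, hadj]
    exact inner_self_eq_norm_sq (𝕜 := ℂ) (s v)
  have h2 : ‖T‖ = ‖s‖ * ‖s‖ := by
    rw [← hs]
    have := CStarRing.norm_star_mul_self (x := s)
    rwa [hsa.star_eq] at this
  have h3 : ‖T v‖ ≤ ‖s‖ * ‖s v‖ := by
    rw [← hs]
    exact s.le_opNorm _
  rw [h1, h2]
  calc ‖T v‖ ^ 2 ≤ (‖s‖ * ‖s v‖) ^ 2 := by gcongr
    _ = _ := by ring

theorem apply_eq_zero_of_inner_eq_zero [CompleteSpace E] {T : E →L[ℂ] E} (hT : 0 ≤ T) {v : E}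
    (hv : ⟪v, T v⟫_ℂ = 0) : T v = 0 := by
  have := norm_sq_apply_le_of_nonneg hT v
  rw [hv, Complex.zero_re, mul_zero] at this
  exact norm_eq_zero.1 (pow_eq_zero_iff two_ne_zero |>.1 (le_antisymm this (sq_nonneg _)))

theorem summable_mul_of_sq {ι : Type*} {f g : ι → ℝ} (hf : Summable fun i => f i ^ 2)
    (hg : Summable fun i => g i ^ 2) : Summable fun i => |f i| * |g i| := by
  refine Summable.of_nonneg_of_le (fun i => by positivity) (fun i => ?_) (hf.add hg)
  nlinarith [sq_nonneg (|f i| - |g i|), sq_abs (f i), sq_abs (g i), abs_nonneg (f i),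
    abs_nonneg (g i)]

/-- If the column `(Nₚ)ₚ` is a contraction and the `dₚ` are uniformly bounded, then
`∑ₚ Nₚ* dₚ Nₚ` converges strongly. -/
theorem exists_hasSum_adjoint_comp [CompleteSpace E] [CompleteSpace F] {ι : Type*}
    (N : ι → E →L[ℂ] F) (hN : ∀ (s : Finset ι) v, ∑ p ∈ s, ‖N p v‖ ^ 2 ≤ ‖v‖ ^ 2)
    (d : ι → F →L[ℂ] F) (C : ℝ) (hd : ∀ p, ‖d p‖ ≤ C) :
    ∃ T : E →L[ℂ] E, ∀ v,
      HasSum (fun p => ContinuousLinearMap.adjoint (N p) (d p (N p v))) (T v) := by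
  have hC' : ∀ p : ι, 0 ≤ C := fun p => (norm_nonneg _).trans (hd p)
  -- Pair the partial sum `w` with itself, apply Cauchy–Schwarz, and use the column bound at `w`:
  -- one factor `‖w‖²` cancels.
  have key : ∀ (s : Finset ι) v,
      ‖∑ p ∈ s, ContinuousLinearMap.adjoint (N p) (d p (N p v))‖ ^ 2 ≤
        C ^ 2 * ∑ p ∈ s, ‖N p v‖ ^ 2 := by
    intro s v
    set w := ∑ p ∈ s, ContinuousLinearMap.adjoint (N p) (d p (N p v)) with hw
    have h1 : ‖w‖ ^ 2 = (∑ p ∈ s, ⟪N p w, d p (N p v)⟫_ℂ).re := by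
      rw [← inner_self_eq_norm_sq (𝕜 := ℂ) w]
      conv_lhs => rw [hw, inner_sum, ← hw]
      simp only [ContinuousLinearMap.adjoint_inner_right]
      rfl
    have h2 : ‖w‖ ^ 2 ≤ ∑ p ∈ s, ‖N p w‖ * (C * ‖N p v‖) := by
      rw [h1, Complex.re_sum]
      refine Finset.sum_le_sum fun p _ => ?_
      refine (Complex.re_le_norm _).trans ((norm_inner_le_norm _ _).trans ?_)
      gcongr
      exact (d p).le_of_opNorm_le (hd p) _
    have h3 := Finset.sum_mul_sq_le_sq_mul_sq s (fun p => ‖N p w‖) (fun p => C * ‖N p v‖)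
    have h4 : (‖w‖ ^ 2) ^ 2 ≤ ‖w‖ ^ 2 * (C ^ 2 * ∑ p ∈ s, ‖N p v‖ ^ 2) := by
      calc (‖w‖ ^ 2) ^ 2 ≤ (∑ p ∈ s, ‖N p w‖ * (C * ‖N p v‖)) ^ 2 := by gcongr
        _ ≤ _ := h3
        _ ≤ _ := by
          simp only [mul_pow, ← Finset.mul_sum]
          gcongr
          exact hN s w
    rcases eq_or_lt_of_le (sq_nonneg ‖w‖) with h0 | h0
    · rw [← h0]; positivity
    · rw [sq (‖w‖ ^ 2)] at h4
      exact le_of_mul_le_mul_left h4 h0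
  have hsumN : ∀ v, Summable fun p => ‖N p v‖ ^ 2 := fun v =>
    summable_of_sum_le (fun p => by positivity) (fun s => hN s v)
  have hsum : ∀ v, Summable fun p => ContinuousLinearMap.adjoint (N p) (d p (N p v)) := by
    intro v
    rw [summable_iff_vanishing_norm]
    intro ε hε
    obtain ⟨s, hs⟩ := summable_iff_vanishing_norm.1 ((hsumN v).mul_left (C ^ 2)) (ε ^ 2)
      (by positivity)
    refine ⟨s, fun t ht => ?_⟩
    have h1 := hs t ht
    rw [← Finset.mul_sum] at h1
    have h2 := (key t v).trans_lt ((le_abs_self _).trans_lt h1)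
    exact lt_of_pow_lt_pow_left₀ 2 hε.le h2
  -- The absolute value is needed because `C` may be negative when `ι` is empty.
  have hbound : ∀ v, ‖∑' p, ContinuousLinearMap.adjoint (N p) (d p (N p v))‖ ≤ |C| * ‖v‖ := by
    intro v
    refine le_of_tendsto (hsum v).hasSum.norm (Eventually.of_forall fun s => ?_)
    refine le_of_sq_le_sq ?_ (by positivity)
    rw [mul_pow, sq_abs]
    exact (key s v).trans (by gcongr; exact hN s v)
  refine ⟨LinearMap.mkContinuous
    { toFun := fun v => ∑' p, ContinuousLinearMap.adjoint (N p) (d p (N p v))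
      map_add' := fun v w => by
        simp only [map_add]
        exact (hsum v).tsum_add (hsum w)
      map_smul' := fun c v => by
        simp only [map_smul, RingHom.id_apply]
        exact (hsum v).tsum_const_smul c } |C| hbound, fun v => (hsum v).hasSum⟩

theorem strongLim_apply [CompleteSpace E] {u : ℕ → E →L[ℂ] E} {T : E →L[ℂ] E}
    (h : ∀ v, Tendsto (fun n => u n v) atTop (𝓝 (T v))) : strongLim u = T := by
  have H : ∃ T : E →L[ℂ] E, ∀ v, Tendsto (fun n => u n v) atTop (𝓝 (T v)) := ⟨T, h⟩
  rw [strongLim, dif_pos H]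
  ext v
  exact tendsto_nhds_unique (H.choose_spec v) (h v)

theorem strongSum_eq [CompleteSpace E] {ι : Type*} {u : ι → E →L[ℂ] E} {T : E →L[ℂ] E}
    (h : ∀ v, HasSum (fun n => u n v) (T v)) : strongSum u = T := by
  have H : ∃ T : E →L[ℂ] E, ∀ v, HasSum (fun n => u n v) (T v) := ⟨T, h⟩
  rw [strongSum, dif_pos H]
  ext v
  exact (H.choose_spec v).unique (h v)

/-- A decreasing sequence of positive operators converges strongly. -/
theorem exists_tendsto_of_antitone [CompleteSpace E] {u : ℕ → E →L[ℂ] E} (hu : Antitone u)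
    (h0 : ∀ n, 0 ≤ u n) (h1 : ∀ n, u n ≤ 1) :
    ∃ T : E →L[ℂ] E, ∀ v, Tendsto (fun n => u n v) atTop (𝓝 (T v)) := by
  have hnorm : ∀ m n, m ≤ n → ‖u m - u n‖ ≤ 1 := fun m n hmn =>
    (CStarAlgebra.norm_le_one_iff_of_nonneg _ (sub_nonneg.2 (hu hmn))).2
      ((sub_le_self _ (h0 n)).trans (h1 m))
  have hre : ∀ v, Antitone fun n => (⟪v, u n v⟫_ℂ).re := fun v m n hmn =>
    (Complex.le_def.1 (ContinuousLinearMap.le_iff_inner.1 (hu hmn) v)).1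
  have hre0 : ∀ v n, 0 ≤ (⟪v, u n v⟫_ℂ).re := fun v n =>
    (Complex.le_def.1 (ContinuousLinearMap.nonneg_iff_inner.1 (h0 n) v)).1
  have hc : ∀ v, ∃ w, Tendsto (fun n => u n v) atTop (𝓝 w) := by
    intro v
    apply cauchySeq_tendsto_of_complete
    -- The quadratic forms decrease and are bounded below, hence are Cauchy; `‖u k - u n‖ ≤ 1` then
    -- controls `‖(u k - u n) v‖²` by their differences.
    have hcau : CauchySeq fun n => (⟪v, u n v⟫_ℂ).re :=
      (tendsto_atTop_ciInf (hre v) ⟨0, by rintro _ ⟨n, rfl⟩; exact hre0 v n⟩).cauchySeq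
    rw [Metric.cauchySeq_iff'] at hcau ⊢
    intro ε hε
    obtain ⟨k, hk⟩ := hcau (ε ^ 2) (by positivity)
    refine ⟨k, fun n hn => ?_⟩
    have h2 := norm_sq_apply_le_of_nonneg (sub_nonneg.2 (hu hn)) v
    have h3 := hk n hn
    rw [dist_comm, Real.dist_eq] at h3
    rw [dist_comm, dist_eq_norm]
    rw [sub_apply, inner_sub_right, Complex.sub_re] at h2
    refine lt_of_pow_lt_pow_left₀ 2 hε.le (lt_of_le_of_lt (h2.trans ?_) h3)
    calc _ ≤ 1 * ((⟪v, u k v⟫_ℂ).re - (⟪v, u n v⟫_ℂ).re) := by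
            gcongr
            · exact sub_nonneg.2 (hre v hn)
            · exact hnorm k n hn
      _ ≤ _ := by rw [one_mul]; exact le_abs_self _
  choose T hT using hc
  exact ⟨continuousLinearMapOfTendsto u (tendsto_pi_nhds.2 hT), hT⟩

end HilbertSpace

theorem HilbertBasis.hasSum_norm_inner_sq {κ E : Type*} [NormedAddCommGroup E]
    [InnerProductSpace ℂ E] (e : HilbertBasis κ ℂ E) (w : E) :
    HasSum (fun k => ‖⟪e k, w⟫_ℂ‖ ^ 2) (‖w‖ ^ 2) := by
  have := (e.hasSum_inner_mul_inner w w).mapL Complex.reCLM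
  convert this using 1
  · ext k
    rw [← inner_conj_symm w, Complex.conj_mul']
    simp [← Complex.ofReal_pow]
  · exact (inner_self_eq_norm_sq (𝕜 := ℂ) w).symm

/-! ### Operators of the form `∑ |v⟩⟨v|` -/

section VecRep

variable {E F : Type*} [NormedAddCommGroup E] [InnerProductSpace ℂ E]
  [NormedAddCommGroup F] [InnerProductSpace ℂ F] {ι : Type*}

/-- `ρ = ∑ |v_α⟩⟨v_α|` with `∑ ‖v_α‖² < ∞`. -/
structure VecRep (v : ι → E) (ρ : E →L[ℂ] E) : Prop where
  summable : Summable fun α => ‖v α‖ ^ 2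
  hasSum : ∀ u, HasSum (fun α => ⟪v α, u⟫_ℂ • v α) (ρ u)

open Classical in
/-- A square summable family, re-indexed by the natural numbers (with zeros added). -/
noncomputable def natReindex (v : ι → E) (hv : Summable fun α => ‖v α‖ ^ 2) (n : ℕ) : E :=
  letI : Encodable (Function.support fun α => ‖v α‖ ^ 2) := hv.countable_support.toEncodable
  match Encodable.decode₂ (Function.support fun α => ‖v α‖ ^ 2) n with
  | some i => v i
  | none => 0

omit [InnerProductSpace ℂ E] in
-- The support is countable, and both the indices off it and the unused integers contribute `f 0 =
-- 0`. Arbitrary index types can thus be traded for `ℕ`, as `IsMixedChain` and `IsLocallyNormal`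
-- require.
theorem hasSum_natReindex (v : ι → E) (hv : Summable fun α => ‖v α‖ ^ 2)
    {G : Type*} [AddCommMonoid G] [TopologicalSpace G] (f : E → G) (hf : f 0 = 0) (a : G) :
    HasSum (fun n => f (natReindex v hv n)) a ↔ HasSum (fun α => f (v α)) a := by
  let : Encodable (Function.support fun α => ‖v α‖ ^ 2) := hv.countable_support.toEncodable
  have h1 : ∀ i : Function.support fun α => ‖v α‖ ^ 2,
      natReindex v hv (Encodable.encode i) = v i := by
    intro i
    simp only [natReindex]
    rw [Encodable.encodek₂]
  rw [← (Encodable.encode_injective (α := Function.support fun α => ‖v α‖ ^ 2)).hasSum_iff]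
  · rw [← hasSum_subtype_iff_of_support_subset
      (s := Function.support fun α => ‖v α‖ ^ 2) (f := fun α => f (v α))]
    · simp only [Function.comp_def, h1]
    · intro α hα h
      refine hα ?_
      have : v α = 0 := by simpa using h
      simp [this, hf]
  · intro n hn
    simp only [natReindex]
    rcases h : Encodable.decode₂ (Function.support fun α => ‖v α‖ ^ 2) n with _ | i
    · simpa using hf
    · exact absurd ⟨i, Encodable.mem_decode₂.1 h⟩ hn

namespace VecRep

variable {v : ι → E} {ρ : E →L[ℂ] E}

theorem reindex (h : VecRep v ρ) : VecRep (natReindex v h.summable) ρ :=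
  ⟨((hasSum_natReindex v h.summable (fun x => ‖x‖ ^ 2) (by simp) _).2 h.summable.hasSum).summable,
    fun u => (hasSum_natReindex v h.summable (fun x => ⟪x, u⟫_ℂ • x) (by simp) _).2 (h.hasSum u)⟩

theorem conj [CompleteSpace E] [CompleteSpace F] (h : VecRep v ρ) (X : E →L[ℂ] F) :
    VecRep (fun α => X (v α)) (X ∘L ρ ∘L ContinuousLinearMap.adjoint X) := by
  refine ⟨?_, fun u => ?_⟩
  · refine Summable.of_nonneg_of_le (fun _ => by positivity) (fun α => ?_)
      (h.summable.mul_left (‖X‖ ^ 2))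
    rw [← mul_pow]
    gcongr
    exact X.le_opNorm _
  · have := (h.hasSum (ContinuousLinearMap.adjoint X u)).mapL X
    simpa [ContinuousLinearMap.adjoint_inner_right] using this

/-- `Tr(ρ x) = ∑ ⟪v_α, x v_α⟫`. -/
theorem hasSum_trace [CompleteSpace E] (h : VecRep v ρ) (x : E →L[ℂ] E) :
    HasSum (fun α => ⟪v α, x (v α)⟫_ℂ) (opTrace (ρ * x)) := by
  set e := stdBasis E
  set x' := ContinuousLinearMap.adjoint x
  -- A product of two square summable double families, hence absolutely summable. By Parseval the
  -- sum over `k` gives `⟪v_α, x v_α⟫`; the sum over `α` gives `⟪e_k, ρ x e_k⟫`.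
  let f : ι × basisIndex E → ℂ := fun p => ⟪x' (v p.1), e p.2⟫_ℂ * ⟪e p.2, v p.1⟫_ℂ
  have hsq := e.hasSum_norm_inner_sq
  have hS : ∀ y : E →L[ℂ] E, Summable fun p : ι × basisIndex E => ‖⟪e p.2, y (v p.1)⟫_ℂ‖ ^ 2 := by
    intro y
    rw [summable_prod_of_nonneg (fun p => by positivity)]
    refine ⟨fun α => (hsq (y (v α))).summable, ?_⟩
    simp only [fun α => (hsq (y (v α))).tsum_eq]
    refine Summable.of_nonneg_of_le (fun _ => by positivity) (fun α => ?_)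
      (h.summable.mul_left (‖y‖ ^ 2))
    rw [← mul_pow]
    gcongr
    exact y.le_opNorm _
  have hf : Summable f := by
    refine Summable.of_norm_bounded (summable_mul_of_sq (hS x') (hS 1)) fun p => ?_
    rw [norm_mul, abs_of_nonneg (norm_nonneg _), abs_of_nonneg (norm_nonneg _), norm_inner_symm]
    rfl
  have h1 : HasSum (fun α => ⟪v α, x (v α)⟫_ℂ) (∑' p, f p) := by
    refine hf.hasSum.prod_fiberwise fun α => ?_
    have := e.hasSum_inner_mul_inner (x' (v α)) (v α)
    rwa [ContinuousLinearMap.adjoint_inner_left] at this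
  have h2 : HasSum (fun k => ⟪e k, (ρ * x) (e k)⟫_ℂ) (∑' p, f p) := by
    have hf' : HasSum (fun q : basisIndex E × ι => f q.swap) (∑' p, f p) :=
      (Equiv.prodComm (basisIndex E) ι).hasSum_iff.2 hf.hasSum
    refine hf'.prod_fiberwise fun k => ?_
    have := (h.hasSum (x (e k))).mapL (innerSL ℂ (e k))
    convert! this using 2 with α
    simp only [f, Prod.swap, innerSL_apply_apply, inner_smul_right]
    rw [ContinuousLinearMap.adjoint_inner_left]
  rw [opTrace, h2.tsum_eq]
  exact h1

theorem hasSum_norm [CompleteSpace E] (h : VecRep v ρ) :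
    HasSum (fun α => ‖v α‖ ^ 2) (opTrace ρ).re := by
  have := (h.hasSum_trace 1).mapL Complex.reCLM
  rw [mul_one] at this
  convert! this using 2 with α
  exact (inner_self_eq_norm_sq (𝕜 := ℂ) _).symm

theorem trace_im [CompleteSpace E] (h : VecRep v ρ) : (opTrace ρ).im = 0 := by
  have := (h.hasSum_trace 1).mapL Complex.imCLM
  rw [mul_one] at this
  refine this.unique ?_
  convert hasSum_zero using 2 with α
  exact inner_self_im (𝕜 := ℂ) (v α)

theorem nonneg (h : VecRep v ρ) : 0 ≤ ρ := by
  rw [ContinuousLinearMap.nonneg_iff_inner]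
  intro u
  have := (h.hasSum u).mapL (innerSL ℂ u)
  refine this.nonneg fun α => ?_
  simp only [innerSL_apply_apply, inner_smul_right]
  rw [← inner_conj_symm, Complex.conj_mul']
  positivity

theorem isTraceClass [CompleteSpace E] (h : VecRep v ρ) : IsTraceClass ρ := by
  have habs : CFC.abs ρ = ρ := CFC.abs_of_nonneg ρ h.nonneg
  rw [IsTraceClass, habs]
  set e := stdBasis E
  have h1 : ∀ k, HasSum (fun α => ‖⟪e k, v α⟫_ℂ‖ ^ 2) (⟪e k, ρ (e k)⟫_ℂ).re := by
    intro k
    have := ((h.hasSum (e k)).mapL (innerSL ℂ (e k))).mapL Complex.reCLM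
    convert! this using 2 with α
    simp only [innerSL_apply_apply, inner_smul_right, Complex.reCLM_apply]
    rw [← inner_conj_symm (e k) (v α), Complex.mul_conj', RCLike.norm_conj]
    simp [← Complex.ofReal_pow]
  have h2 := e.hasSum_norm_inner_sq
  have h3 : Summable fun p : ι × basisIndex E => ‖⟪e p.2, v p.1⟫_ℂ‖ ^ 2 := by
    rw [summable_prod_of_nonneg (fun p => by positivity)]
    refine ⟨fun α => (h2 (v α)).summable, ?_⟩
    simpa only [fun α => (h2 (v α)).tsum_eq] using h.summable
  have h4 := (Equiv.prodComm (basisIndex E) ι).summable_iff.2 h3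
  have h5 := h4.prod
  exact h5.congr fun k => (h1 k).tsum_eq

/-- Norm convergent sums of operators `∑_α |v_{p α}⟩⟨v_{p α}|`. -/
theorem tsum [CompleteSpace E] {κ : Type*} {v : κ → ι → E} {ρ : κ → E →L[ℂ] E}
    (h : ∀ p, VecRep (v p) (ρ p)) (hs : Summable fun q : κ × ι => ‖v q.1 q.2‖ ^ 2) :
    VecRep (fun q : κ × ι => v q.1 q.2) (∑' p, ρ p) := by
  -- This bound makes the operator sum converge in norm, so that `∑' p, ρ p` is not a default value.
  have hn : ∀ p, ‖ρ p‖ ≤ ∑' α, ‖v p α‖ ^ 2 := by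
    intro p
    refine (ρ p).opNorm_le_bound (tsum_nonneg fun _ => by positivity) fun u => ?_
    rw [← ((h p).hasSum u).tsum_eq, ← tsum_mul_right]
    refine tsum_of_norm_bounded ((h p).summable.mul_right ‖u‖).hasSum fun α => ?_
    rw [norm_smul]
    calc _ ≤ (‖v p α‖ * ‖u‖) * ‖v p α‖ := by gcongr; exact norm_inner_le_norm _ _
      _ = _ := by ring
  have hρ : Summable ρ := Summable.of_norm_bounded hs.prod hn
  refine ⟨hs, fun u => ?_⟩
  have h1 : Summable fun q : κ × ι => ⟪v q.1 q.2, u⟫_ℂ • v q.1 q.2 := by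
    refine Summable.of_norm_bounded (hs.mul_right ‖u‖) fun q => ?_
    rw [norm_smul]
    calc _ ≤ (‖v q.1 q.2‖ * ‖u‖) * ‖v q.1 q.2‖ := by gcongr; exact norm_inner_le_norm _ _
      _ = _ := by ring
  have h2 := h1.hasSum.prod_fiberwise fun p => (h p).hasSum u
  have h3 := hρ.hasSum.mapL (ContinuousLinearMap.apply ℂ E u)
  rw [show (∑' p, ρ p) u = _ from h3.unique h2]
  exact h1.hasSum

end VecRep

/-- Expand `s u` in the basis, with `s = √ρ`, and apply `s`: `ρ u = ∑ ⟪e_k, s u⟫ s e_k = ∑ ⟪s e_k,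
u⟫ s e_k`. -/
theorem IsTraceClass.vecRep [CompleteSpace E] {ρ : E →L[ℂ] E} (h0 : 0 ≤ ρ)
    (h : IsTraceClass ρ) : VecRep (fun k => CFC.sqrt ρ (stdBasis E k)) ρ := by
  set s := CFC.sqrt ρ
  have hs : s * s = ρ := CFC.sqrt_mul_sqrt_self ρ h0
  have hadj : ContinuousLinearMap.adjoint s = s := (CFC.sqrt_nonneg ρ).isSelfAdjoint
  have habs : CFC.abs ρ = ρ := CFC.abs_of_nonneg ρ h0
  refine ⟨?_, fun u => ?_⟩
  · rw [IsTraceClass, habs] at h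
    convert h using 2 with k
    rw [← hs, mul_apply_eq_comp, ← ContinuousLinearMap.adjoint_inner_left, hadj]
    exact (inner_self_eq_norm_sq (𝕜 := ℂ) _).symm
  · have := ((stdBasis E).hasSum_repr (s u)).mapL s
    rw [← mul_apply_eq_comp, hs] at this
    convert this using 2 with k
    rw [map_smul, HilbertBasis.repr_apply_apply, ← ContinuousLinearMap.adjoint_inner_left, hadj]

end VecRep

/-! ### Generated von Neumann algebras -/

section Generated

variable {E : Type*} [NormedAddCommGroup E] [InnerProductSpace ℂ E] [CompleteSpace E]

/-- The operators commuting with `S` and its adjoints are closed under `star`, so the condition for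
`star z` need not be stated separately. -/
theorem mem_generatedVN {S : Set (E →L[ℂ] E)} {T : E →L[ℂ] E} :
    T ∈ generatedVN S ↔
      ∀ z : E →L[ℂ] E, (∀ g ∈ S, g * z = z * g ∧ star g * z = z * star g) → z * T = T * z := by
  change T ∈ StarSubalgebra.centralizer ℂ (StarSubalgebra.centralizer ℂ S : Set (E →L[ℂ] E)) ↔ _
  rw [StarSubalgebra.mem_centralizer_iff]
  constructor
  · intro h z hz
    exact (h z ((StarSubalgebra.mem_centralizer_iff ℂ).2 hz)).1
  · intro h z hz
    exact ⟨h z ((StarSubalgebra.mem_centralizer_iff ℂ).1 hz),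
      h (star z) ((StarSubalgebra.mem_centralizer_iff ℂ).1 (star_mem hz))⟩

theorem subset_generatedVN (S : Set (E →L[ℂ] E)) : S ⊆ generatedVN S := fun _ hT =>
  mem_generatedVN.2 fun _ hz => (hz _ hT).1.symm

end Generated

/-! ### The operators `I ⊗ ⋯ ⊗ I ⊗ a ⊗ I ⊗ ⋯` -/

section Legs

variable {h : Type*} [NormedAddCommGroup h] [InnerProductSpace ℂ h]

theorem InfTensor.clm_ext {F : Type*} [NormedAddCommGroup F] [NormedSpace ℂ F]
    {S T : InfTensor h →L[ℂ] F} (H : ∀ f, S (productVec f) = T (productVec f)) : S = T := by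
  have h1 : (S.comp PreTensor.toInf : PreTensor h →L[ℂ] F) = T.comp PreTensor.toInf := by
    apply ContinuousLinearMap.coe_injective
    apply Finsupp.lhom_ext
    intro f c
    have : Finsupp.single f c = c • (Finsupp.single f (1 : ℂ) : PreTensor h) := by
      rw [Finsupp.smul_single, smul_eq_mul, mul_one]
    rw [this, map_smul, map_smul]
    exact congrArg _ (H f)
  have hd : DenseRange (PreTensor.toInf : PreTensor h → InfTensor h) :=
    UniformSpace.Completion.denseRange_coe
  ext x
  refine congrFun (hd.equalizer S.continuous T.continuous ?_) x
  funext y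
  exact DFunLike.congr_fun h1 y

theorem InfTensor.ext_productVec {x y : InfTensor h}
    (H : ∀ f, ⟪x, productVec f⟫_ℂ = ⟪y, productVec f⟫_ℂ) : x = y := by
  have : innerSL ℂ x = innerSL ℂ y := InfTensor.clm_ext H
  exact ext_inner_right ℂ fun v => DFunLike.congr_fun this v

omit [InnerProductSpace ℂ h] in
theorem TensorSeq.ext {f g : TensorSeq h} (H : f.1 = g.1) : f = g := by
  cases f; cases g; congr

theorem TensorSeq.act_act (n : ℕ) (a b : h →L[ℂ] h) (f : TensorSeq h) :
    (f.act n b).act n a = f.act n (a * b) := by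
  apply TensorSeq.ext
  simp [TensorSeq.act]

theorem TensorSeq.act_comm {m n : ℕ} (hmn : m ≠ n) (a b : h →L[ℂ] h) (f : TensorSeq h) :
    (f.act n b).act m a = (f.act m a).act n b := by
  apply TensorSeq.ext
  simp only [TensorSeq.act, Function.update_of_ne hmn, Function.update_of_ne hmn.symm]
  exact Function.update_comm hmn.symm _ _ _

theorem TensorSeq.act_eq_self {n : ℕ} {a : h →L[ℂ] h} {f : TensorSeq h} (H : a (f.1 n) = f.1 n) :
    f.act n a = f := by
  apply TensorSeq.ext
  simp [TensorSeq.act, H]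

theorem leg_mul_leg (n : ℕ) (a b : h →L[ℂ] h) : leg n a * leg n b = leg n (a * b) :=
  InfTensor.clm_ext fun f => by
    rw [mul_apply_eq_comp, leg_productVec, leg_productVec, leg_productVec,
      TensorSeq.act_act]

theorem leg_comm {m n : ℕ} (hmn : m ≠ n) (a b : h →L[ℂ] h) :
    leg m a * leg n b = leg n b * leg m a :=
  InfTensor.clm_ext fun f => by
    simp only [mul_apply_eq_comp, leg_productVec, TensorSeq.act_comm hmn]

theorem leg_one (n : ℕ) : leg n (1 : h →L[ℂ] h) = 1 :=
  InfTensor.clm_ext fun f => by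
    rw [leg_productVec, TensorSeq.act_eq_self rfl]; rfl

theorem tailMatrix_act_left (n : ℕ) (a : h →L[ℂ] h) (f g : TensorSeq h) :
    tailMatrix (f.act n a) g = tailMatrix f g := by
  have : (∀ᶠ m in atTop, (f.act n a).1 m = g.1 m) ↔ ∀ᶠ m in atTop, f.1 m = g.1 m := by
    apply eventually_congr
    filter_upwards [eventually_ne_atTop n] with m hm
    simp [TensorSeq.act, Function.update_of_ne hm]
  classical
  simp only [tailMatrix]
  exact if_congr this rfl rfl

theorem tailMatrix_act_right (n : ℕ) (a : h →L[ℂ] h) (f g : TensorSeq h) :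
    tailMatrix f (g.act n a) = tailMatrix f g := by
  have : (∀ᶠ m in atTop, f.1 m = (g.act n a).1 m) ↔ ∀ᶠ m in atTop, f.1 m = g.1 m := by
    apply eventually_congr
    filter_upwards [eventually_ne_atTop n] with m hm
    simp [TensorSeq.act, Function.update_of_ne hm]
  classical
  simp only [tailMatrix]
  exact if_congr this rfl rfl

theorem tensorKernel_act_left [CompleteSpace h] (n : ℕ) (a : h →L[ℂ] h) (f g : TensorSeq h) :
    tensorKernel (f.act n a) g = tensorKernel f (g.act n (star a)) := by
  obtain ⟨N, h1, h2⟩ := ((tensorKernel_eventually (f.act n a) g).and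
    (tensorKernel_eventually f (g.act n (star a)))).exists
  rw [← h1, ← h2, tailMatrix_act_left, tailMatrix_act_right]
  congr 1
  refine Finset.prod_congr rfl fun m _ => ?_
  rcases eq_or_ne m n with rfl | hm
  · simp [TensorSeq.act, ContinuousLinearMap.star_eq_adjoint,
      ContinuousLinearMap.adjoint_inner_right]
  · simp [TensorSeq.act, Function.update_of_ne hm]

theorem tensorKernel_act_smul_left (n : ℕ) (c : ℂ) (a : h →L[ℂ] h) (f g : TensorSeq h) :
    tensorKernel (f.act n (c • a)) g = star c * tensorKernel (f.act n a) g := by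
  obtain ⟨N, h1, h2, hN⟩ := ((tensorKernel_eventually (f.act n (c • a)) g).and
    ((tensorKernel_eventually (f.act n a) g).and (eventually_gt_atTop n))).exists
  have hmem : n ∈ Finset.range N := Finset.mem_range.2 hN
  rw [← h1, ← h2, tailMatrix_act_left, tailMatrix_act_left,
    ← Finset.mul_prod_erase _ _ hmem,
    ← Finset.mul_prod_erase _ (fun m => ⟪(f.act n a).1 m, g.1 m⟫_ℂ) hmem]
  have h3 : ∏ m ∈ (Finset.range N).erase n, ⟪(f.act n (c • a)).1 m, g.1 m⟫_ℂ =
      ∏ m ∈ (Finset.range N).erase n, ⟪(f.act n a).1 m, g.1 m⟫_ℂ := by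
    refine Finset.prod_congr rfl fun m hm => ?_
    simp [TensorSeq.act, Function.update_of_ne (Finset.ne_of_mem_erase hm)]
  rw [h3]
  simp only [TensorSeq.act, Function.update_self, smul_apply,
    inner_smul_left, starRingEnd_apply]
  ring

/-- Scaling an entry and scaling the product vector give different formal combinations. They agree
in the completion because they have the same inner products with all product vectors. -/
theorem leg_smul (n : ℕ) (c : ℂ) (a : h →L[ℂ] h) : leg n (c • a) = c • leg n a :=
  InfTensor.clm_ext fun f => InfTensor.ext_productVec fun g => by
    rw [smul_apply, inner_smul_left, leg_productVec, leg_productVec,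
      inner_productVec, inner_productVec, tensorKernel_act_smul_left, starRingEnd_apply]

variable [CompleteSpace h]

theorem star_leg (n : ℕ) (a : h →L[ℂ] h) : star (leg n a) = leg n (star a) := by
  symm
  refine (ContinuousLinearMap.eq_adjoint_iff _ _).2 fun x y => ?_
  -- The adjoint relation, known on pairs of product vectors, is extended by density in one variable
  -- and then in the other.
  have h1 : ∀ f, (innerSL ℂ (productVec f)) ∘L leg n a =
      innerSL ℂ (leg n (star a) (productVec f)) := fun f => InfTensor.clm_ext fun g => by
    simp only [ContinuousLinearMap.comp_apply, innerSL_apply_apply, leg_productVec,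
      inner_productVec]
    rw [tensorKernel_act_left, star_star]
  have h2 : (innerSL ℂ y) ∘L leg n (star a) = innerSL ℂ (leg n a y) :=
    InfTensor.clm_ext fun f => by
      have := DFunLike.congr_fun (h1 f) y
      simp only [ContinuousLinearMap.comp_apply, innerSL_apply_apply] at this ⊢
      rw [← inner_conj_symm, ← this, inner_conj_symm]
  have := DFunLike.congr_fun h2 x
  simp only [ContinuousLinearMap.comp_apply, innerSL_apply_apply] at this
  rw [← inner_conj_symm, this, inner_conj_symm]

theorem leg_mem_localAlgebra (𝓑 : VonNeumannAlgebra h) {k n : ℕ} (hkn : k ≤ n) {a : h →L[ℂ] h}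
    (ha : a ∈ 𝓑) : leg k a ∈ localAlgebra 𝓑 n :=
  subset_generatedVN _ ⟨k, hkn, a, ha, rfl⟩

/-- An operator in a slot beyond `n` commutes with all generators and their adjoints, so it lies in
the commutant; `b` need not belong to `𝓑`. -/
theorem commute_leg_of_mem_localAlgebra {𝓑 : VonNeumannAlgebra h} {k n : ℕ} (hkn : n < k)
    {T : InfTensor h →L[ℂ] InfTensor h} (hT : T ∈ localAlgebra 𝓑 n) (b : h →L[ℂ] h) :
    Commute T (leg k b) := by
  refine (mem_generatedVN.1 hT _ ?_).symm
  rintro _ ⟨j, hj, a, -, rfl⟩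
  have hne : j ≠ k := by omega
  rw [star_leg]
  exact ⟨leg_comm hne _ _, leg_comm hne _ _⟩

omit [CompleteSpace h] in
theorem localProduct_succ (a : ℕ → h →L[ℂ] h) (n : ℕ) :
    localProduct a (n + 1) = localProduct a n * leg (n + 1) (a (n + 1)) := by
  rw [localProduct, List.range_succ, List.map_append, List.prod_append]
  simp [localProduct]

omit [CompleteSpace h] in
theorem localProduct_zero (a : ℕ → h →L[ℂ] h) : localProduct a 0 = leg 0 (a 0) := by
  simp [localProduct]

theorem localProduct_mem {𝓑 : VonNeumannAlgebra h} {a : ℕ → h →L[ℂ] h} (ha : ∀ k, a k ∈ 𝓑)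
    (n : ℕ) : localProduct a n ∈ localAlgebra 𝓑 n := by
  change _ ∈ (localAlgebra 𝓑 n).toStarSubalgebra
  refine list_prod_mem fun T hT => ?_
  obtain ⟨k, hk, rfl⟩ := List.mem_map.1 hT
  exact leg_mem_localAlgebra 𝓑 (Nat.lt_succ_iff.1 (List.mem_range.1 hk)) (ha k)

omit [CompleteSpace h] in
theorem localProduct_update_one (n : ℕ) (x : h →L[ℂ] h) :
    localProduct (Function.update 1 n x) n = leg n x := by
  have h1 : ∀ k < n, leg k ((Function.update 1 n x : ℕ → h →L[ℂ] h) k) = 1 := fun k hk => by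
    rw [Function.update_of_ne hk.ne, Pi.one_apply, leg_one]
  rw [localProduct, List.range_succ, List.map_append, List.prod_append, List.prod_eq_one]
  · simp
  · intro T hT
    obtain ⟨k, hk, rfl⟩ := List.mem_map.1 hT
    exact h1 k (List.mem_range.1 hk)

/-- `|η⟩⟨Ω|` in slot `n` writes `η` over a placeholder `Ω`. Conjugation by it turns an observable of
that slot into its expectation at `η`, which is how path tensors are evaluated one factor at a time.
-/
theorem leg_conj_rankOne (n : ℕ) (a : h →L[ℂ] h) (η Ω : h) :
    star (leg n (InnerProductSpace.rankOne ℂ η Ω)) * leg n a *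
      leg n (InnerProductSpace.rankOne ℂ η Ω) =
      ⟪η, a η⟫_ℂ • leg n (InnerProductSpace.rankOne ℂ Ω Ω) := by
  rw [star_leg, leg_mul_leg, leg_mul_leg, ← leg_smul]
  congr 1
  ext v
  simp [ContinuousLinearMap.star_eq_adjoint, smul_smul, mul_comm]

end Legs

/-! ### Abstract chains with transition expectations `∑ₚ cₚ(x) Nₚ* y Nₚ` -/

section Chain

variable {h : Type*} [NormedAddCommGroup h] [InnerProductSpace ℂ h] {P : Type*}

/-- The transition expectations `E n x y = ∑ₚ cₚ(x) Nₚ* y Nₚ`, where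
`cₚ(x) = ∑_α ⟪η n p α, x (η n p α)⟫` and the column `(Nₚ)ₚ` is an isometry, together with
density operators `ρ n` which are transported by them. -/
structure IsMixedChain [CompleteSpace h] (N : P → h →L[ℂ] h) (η : ℕ → P → ℕ → h)
    (E : ℕ → (h →L[ℂ] h) → (h →L[ℂ] h) → (h →L[ℂ] h)) (ρ : ℕ → h →L[ℂ] h) : Prop where
  hasSum_norm : ∀ v, HasSum (fun p => ‖N p v‖ ^ 2) (‖v‖ ^ 2)
  summable_vec : ∀ n p, Summable fun α => ‖η n p α‖ ^ 2
  -- Only `≤ 1`: for the walk the vectors vanish at sites where the block of `ρ n` is zero.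
  tsum_vec_le : ∀ n p, ∑' α, ‖η n p α‖ ^ 2 ≤ 1
  hasSum_inner : ∀ n x y v w,
    HasSum (fun p => (∑' α, ⟪η n p α, x (η n p α)⟫_ℂ) * ⟪N p v, y (N p w)⟫_ℂ) ⟪v, E n x y w⟫_ℂ
  dual : ∀ n y, opTrace (ρ (n + 1) * y) = opTrace (ρ n * E n 1 y)
  exists_rep : ∀ n, ∃ w : ℕ → h, VecRep w (ρ n)
  trace_eq_one : ∀ n, opTrace (ρ n) = 1

theorem norm_inner_apply_le (x : h →L[ℂ] h) (v w : h) : ‖⟪v, x w⟫_ℂ‖ ≤ ‖x‖ * (‖v‖ * ‖w‖) :=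
  calc _ ≤ ‖v‖ * (‖x‖ * ‖w‖) := (norm_inner_le_norm _ _).trans (by gcongr; exact x.le_opNorm _)
    _ = _ := by ring

theorem summable_inner_apply {ι : Type*} {v : ι → h} (hv : Summable fun α => ‖v α‖ ^ 2)
    (x : h →L[ℂ] h) : Summable fun α => ⟪v α, x (v α)⟫_ℂ :=
  Summable.of_norm_bounded (hv.mul_left ‖x‖) fun α => by
    simpa only [sq] using norm_inner_apply_le x (v α) (v α)

theorem ContinuousLinearMap.inner_ext {S T : h →L[ℂ] h} (H : ∀ v w, ⟪v, S w⟫_ℂ = ⟪v, T w⟫_ℂ) :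
    S = T := by
  ext w
  exact ext_inner_left ℂ fun v => H v w

theorem tsum_inner_one_apply {ι : Type*} (v : ι → h) :
    ∑' α, ⟪v α, (1 : h →L[ℂ] h) (v α)⟫_ℂ = ((∑' α, ‖v α‖ ^ 2 : ℝ) : ℂ) := by
  rw [Complex.ofReal_tsum]
  refine tsum_congr fun α => ?_
  rw [one_apply_eq_self, inner_self_eq_norm_sq_to_K]
  simp

theorem tsum_inner_one_apply_nonneg {ι : Type*} (v : ι → h) :
    0 ≤ ∑' α, ⟪v α, (1 : h →L[ℂ] h) (v α)⟫_ℂ := by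
  rw [tsum_inner_one_apply, Complex.zero_le_real]
  exact tsum_nonneg fun _ => by positivity

namespace IsMixedChain

variable [CompleteSpace h] {N : P → h →L[ℂ] h} {η : ℕ → P → ℕ → h}
  {E : ℕ → (h →L[ℂ] h) → (h →L[ℂ] h) → (h →L[ℂ] h)} {ρ : ℕ → h →L[ℂ] h}

section Transition

variable (C : IsMixedChain N η E ρ)
include C

theorem weight_one_le (n : ℕ) (p : P) :
    ∑' α, ⟪η n p α, (1 : h →L[ℂ] h) (η n p α)⟫_ℂ ≤ 1 := by
  rw [tsum_inner_one_apply, ← Complex.ofReal_one, Complex.real_le_real]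
  exact C.tsum_vec_le n p

theorem add_left (n : ℕ) (x x' y : h →L[ℂ] h) : E n (x + x') y = E n x y + E n x' y :=
  ContinuousLinearMap.inner_ext fun v w => by
    rw [add_apply, inner_add_right]
    refine (C.hasSum_inner n (x + x') y v w).unique ?_
    convert! (C.hasSum_inner n x y v w).add (C.hasSum_inner n x' y v w) using 2 with p
    rw [← add_mul, ← (summable_inner_apply (C.summable_vec n p) x).tsum_add
      (summable_inner_apply (C.summable_vec n p) x')]
    simp

theorem smul_left (n : ℕ) (c : ℂ) (x y : h →L[ℂ] h) : E n (c • x) y = c • E n x y :=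
  ContinuousLinearMap.inner_ext fun v w => by
    rw [smul_apply, inner_smul_right]
    refine (C.hasSum_inner n (c • x) y v w).unique ?_
    convert! (C.hasSum_inner n x y v w).mul_left c using 2 with p
    rw [← mul_assoc, ← tsum_mul_left]
    simp

theorem add_right (n : ℕ) (x y y' : h →L[ℂ] h) : E n x (y + y') = E n x y + E n x y' :=
  ContinuousLinearMap.inner_ext fun v w => by
    rw [add_apply, inner_add_right]
    refine (C.hasSum_inner n x (y + y') v w).unique ?_
    convert! (C.hasSum_inner n x y v w).add (C.hasSum_inner n x y' v w) using 2 with p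
    rw [add_apply, inner_add_right, mul_add]

theorem smul_right (n : ℕ) (c : ℂ) (x y : h →L[ℂ] h) : E n x (c • y) = c • E n x y :=
  ContinuousLinearMap.inner_ext fun v w => by
    rw [smul_apply, inner_smul_right]
    refine (C.hasSum_inner n x (c • y) v w).unique ?_
    convert! (C.hasSum_inner n x y v w).mul_left c using 2 with p
    rw [smul_apply, inner_smul_right]
    ring

theorem mono (n : ℕ) {y y' : h →L[ℂ] h} (H : y ≤ y') : E n 1 y ≤ E n 1 y' := by
  rw [ContinuousLinearMap.le_iff_inner] at H ⊢
  intro v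
  refine hasSum_le (fun p => ?_) (C.hasSum_inner n 1 y v v) (C.hasSum_inner n 1 y' v v)
  exact mul_le_mul_of_nonneg_left (H _) (tsum_inner_one_apply_nonneg _)

theorem nonneg (n : ℕ) {y : h →L[ℂ] h} (H : 0 ≤ y) : 0 ≤ E n 1 y := by
  rw [ContinuousLinearMap.nonneg_iff_inner] at H ⊢
  exact fun v => (C.hasSum_inner n 1 y v v).nonneg fun p =>
    mul_nonneg (tsum_inner_one_apply_nonneg _) (H _)

theorem one_one_le (n : ℕ) : E n 1 1 ≤ 1 := by
  rw [ContinuousLinearMap.le_iff_inner]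
  intro v
  have h1 : HasSum (fun p => ⟪N p v, (1 : h →L[ℂ] h) (N p v)⟫_ℂ) ⟪v, (1 : h →L[ℂ] h) v⟫_ℂ := by
    have := (C.hasSum_norm v).mapL Complex.ofRealCLM
    convert! this using 2 with p
    · simp [inner_self_eq_norm_sq_to_K]
    · simp [inner_self_eq_norm_sq_to_K]
  refine hasSum_le (fun p => ?_) (C.hasSum_inner n 1 1 v v) h1
  refine mul_le_of_le_one_left ?_ (C.weight_one_le n p)
  exact ContinuousLinearMap.nonneg_iff_inner.1 zero_le_one _

/-- For fixed index of the column and fixed `α`, the form sums the entries of a Hadamard product of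
two Gram matrices, which is positive semidefinite by Schur's theorem. -/
theorem completely_positive (n M : ℕ) (x y c : Fin M → h →L[ℂ] h) :
    0 ≤ ∑ p, ∑ q, star (c p) * E n (star (x p) * x q) (star (y p) * y q) * c q := by
  rw [ContinuousLinearMap.nonneg_iff_inner]
  intro v
  have h1 := hasSum_sum (s := Finset.univ) fun (p : Fin M) _ =>
    hasSum_sum (s := Finset.univ) fun (q : Fin M) _ =>
      C.hasSum_inner n (star (x p) * x q) (star (y p) * y q) (c p v) (c q v)
  have h2 : ⟪v, (∑ p, ∑ q, star (c p) * E n (star (x p) * x q) (star (y p) * y q) * c q) v⟫_ℂ =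
      ∑ p, ∑ q, ⟪c p v, E n (star (x p) * x q) (star (y p) * y q) (c q v)⟫_ℂ := by
    simp only [sum_apply, inner_sum, mul_apply_eq_comp, ContinuousLinearMap.star_eq_adjoint,
      ContinuousLinearMap.adjoint_inner_right]
  rw [h2]
  refine h1.nonneg fun k => ?_
  have h3 : HasSum (fun α => ∑ p, ∑ q, ⟪x p (η n k α), x q (η n k α)⟫_ℂ *
      ⟪y p (N k (c p v)), y q (N k (c q v))⟫_ℂ)
      (∑ p, ∑ q, (∑' α, ⟪η n k α, (star (x p) * x q) (η n k α)⟫_ℂ) *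
        ⟪N k (c p v), (star (y p) * y q) (N k (c q v))⟫_ℂ) := by
    refine hasSum_sum fun p _ => hasSum_sum fun q _ => ?_
    have := (summable_inner_apply (C.summable_vec n k) (star (x p) * x q)).hasSum.mul_right
      ⟪N k (c p v), (star (y p) * y q) (N k (c q v))⟫_ℂ
    convert! this using 2 with α
    simp only [mul_apply_eq_comp, ContinuousLinearMap.star_eq_adjoint,
      ContinuousLinearMap.adjoint_inner_right]
  refine h3.nonneg fun α => ?_
  have h4 := (gram_posSemidef fun p => x p (η n k α)).hadamard
    (gram_posSemidef fun p => y p (N k (c p v)))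
  have h5 := h4.dotProduct_mulVec_nonneg (fun _ => 1)
  simpa [dotProduct, Matrix.mulVec, Matrix.hadamard_apply, Matrix.gram_apply] using h5

theorem isTransitionExpectation {𝓑 : VonNeumannAlgebra h} (n : ℕ)
    (hmem : ∀ x y, E n x y ∈ 𝓑) : IsTransitionExpectation 𝓑 (E n) where
  mem x _ y _ := hmem x y
  add_left x _ x' _ y _ := C.add_left n x x' y
  smul_left c x _ y _ := C.smul_left n c x y
  add_right x _ y _ y' _ := C.add_right n x y y'
  smul_right c x _ y _ := C.smul_right n c x y
  completely_positive M x y c _ _ _ := C.completely_positive n M x y c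
  subMarkovian := C.one_one_le n

/-! The limits `b̄(n)`. -/

theorem nestedUnit_nonneg (k n : ℕ) : 0 ≤ nestedUnit E k n := by
  induction k generalizing n with
  | zero => exact C.nonneg n zero_le_one
  | succ k ih => exact C.nonneg n (ih _)

/-- Consecutive terms differ only in the innermost place, where `E _ 1 1 ≤ 1`; monotonicity carries
this outwards. -/
theorem nestedUnit_antitone (n : ℕ) : Antitone fun k => nestedUnit E k n := by
  refine antitone_nat_of_succ_le fun k => ?_
  induction k generalizing n with
  | zero => exact C.mono n (C.one_one_le _)
  | succ k ih => exact C.mono n (ih _)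

theorem nestedUnit_le_one (k n : ℕ) : nestedUnit E k n ≤ 1 :=
  (C.nestedUnit_antitone n (Nat.zero_le k)).trans (C.one_one_le n)

theorem tendsto_nestedUnit (n : ℕ) (v : h) :
    Tendsto (fun k => nestedUnit E k n v) atTop (𝓝 (bBar E n v)) := by
  obtain ⟨T, hT⟩ := exists_tendsto_of_antitone (C.nestedUnit_antitone n)
    (fun k => C.nestedUnit_nonneg k n) fun k => C.nestedUnit_le_one k n
  rw [bBar, strongLim_apply hT]
  exact hT v

/-- Dominated convergence over `p`: the nested units lie between `0` and `1` and the weights are at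
most `1`, so `‖Nₚ v‖ ‖Nₚ w‖` is a summable majorant. -/
theorem transition_bBar (n : ℕ) : E n 1 (bBar E (n + 1)) = bBar E n :=
  ContinuousLinearMap.inner_ext fun v w => by
    have h1 : Tendsto (fun k => ⟪v, nestedUnit E (k + 1) n w⟫_ℂ) atTop (𝓝 ⟪v, bBar E n w⟫_ℂ) :=
      (tendsto_const_nhds.inner (C.tendsto_nestedUnit n w)).comp (tendsto_add_atTop_nat 1)
    refine tendsto_nhds_unique ?_ h1
    have hb : Summable fun p => ‖N p v‖ * ‖N p w‖ := by
      simpa only [abs_norm] using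
        summable_mul_of_sq (C.hasSum_norm v).summable (C.hasSum_norm w).summable
    have h2 := tendsto_tsum_of_dominated_convergence (𝓕 := atTop)
      (f := fun k p => (∑' α, ⟪η n p α, (1 : h →L[ℂ] h) (η n p α)⟫_ℂ) *
        ⟪N p v, nestedUnit E k (n + 1) (N p w)⟫_ℂ)
      (g := fun p => (∑' α, ⟪η n p α, (1 : h →L[ℂ] h) (η n p α)⟫_ℂ) *
        ⟪N p v, bBar E (n + 1) (N p w)⟫_ℂ) hb
      (fun p => tendsto_const_nhds.mul
        (tendsto_const_nhds.inner (C.tendsto_nestedUnit (n + 1) (N p w))))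
      (Eventually.of_forall fun k p => by
        have h3 : ‖nestedUnit E k (n + 1)‖ ≤ 1 :=
          (CStarAlgebra.norm_le_one_iff_of_nonneg _ (C.nestedUnit_nonneg _ _)).2
            (C.nestedUnit_le_one _ _)
        have h4 : ‖∑' α, ⟪η n p α, (1 : h →L[ℂ] h) (η n p α)⟫_ℂ‖ ≤ 1 := by
          rw [tsum_inner_one_apply, Complex.norm_real, Real.norm_of_nonneg
            (tsum_nonneg fun _ => by positivity)]
          exact C.tsum_vec_le n p
        rw [norm_mul]
        calc _ ≤ 1 * (1 * (‖N p v‖ * ‖N p w‖)) := by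
              gcongr
              exact (norm_inner_apply_le _ _ _).trans (by gcongr)
          _ = _ := by ring)
    rw [(C.hasSum_inner n 1 _ v w).tsum_eq] at h2
    simp only [fun k => (C.hasSum_inner n 1 (nestedUnit E k (n + 1)) v w).tsum_eq] at h2
    exact h2

/-- Duality absorbs one transition after another into the state, so the defect `1 - E n 1 1` is
invisible to `ρ n`. -/
theorem trace_nestedUnit (k n : ℕ) : opTrace (ρ n * nestedUnit E k n) = 1 := by
  induction k generalizing n with
  | zero =>
    rw [nestedUnit, ← C.dual, mul_one]
    exact C.trace_eq_one _
  | succ k ih =>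
    rw [nestedUnit, ← C.dual]
    exact ih _

theorem nestedExp_add_one {a : ℕ → h →L[ℂ] h} {m k : ℕ}
    (ha : a (m + k + 1) = 1) : nestedExp E a (k + 1) m = nestedExp E a k m := by
  induction k generalizing m with
  | zero =>
    rw [nestedExp, nestedExp, nestedExp, ha, C.transition_bBar]
  | succ k ih =>
    change E m (a m) _ = E m (a m) _
    rw [ih (m := m + 1) (by rw [← ha]; congr 1; ring)]

/-- The trailing units are absorbed by `b̄`, so the sequence whose strong limit is taken is constant
from `n` on. -/
theorem condExp₀_update_one (n : ℕ) (x : h →L[ℂ] h) :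
    condExp₀ E (Function.update 1 n x) = condExpLocal E (Function.update 1 n x) n := by
  have h1 : ∀ m ≥ n, condExpLocal E (Function.update 1 n x) m =
      condExpLocal E (Function.update 1 n x) n := by
    intro m hm
    induction m, hm using Nat.le_induction with
    | base => rfl
    | succ m hm ih =>
      rw [← ih]
      refine C.nestedExp_add_one ?_
      rw [Function.update_of_ne (by omega), Pi.one_apply]
  refine strongLim_apply fun v => tendsto_const_nhds.congr' ?_
  filter_upwards [eventually_ge_atTop n] with m hm
  rw [h1 m hm]

end Transition

end IsMixedChain

end Chain

/-! ### Expansion over paths -/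

section Paths

universe w

/-- An index of the initial state, followed by `n` steps and, for each of them, an index of the
site state. -/
def PathIndex (P : Type w) : ℕ → Type w
  | 0 => ULift.{w} ℕ
  | n + 1 => PathIndex P n × (P × ℕ)

variable {h : Type*} [NormedAddCommGroup h] [InnerProductSpace ℂ h] {P : Type w}

/-- The vector obtained from `u` by applying the operators `N p` along a path. -/
def pathVec (N : P → h →L[ℂ] h) (u : ℕ → h) : (n : ℕ) → PathIndex P n → h
  | 0, x => u x.down
  | n + 1, x => N x.2.1 (pathVec N u n x.1)

/-- The product vector `η₀ ⊗ ⋯ ⊗ ηₙ₋₁ ⊗ Ω ⊗ Ω ⊗ ⋯` along a path. -/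
noncomputable def pathTensor (η : ℕ → P → ℕ → h) (Ω : h) (hΩ : ‖Ω‖ = 1) :
    (n : ℕ) → PathIndex P n → InfTensor h
  | 0, _ => productVec ⟨fun _ => Ω, Eventually.of_forall fun _ => hΩ⟩
  | n + 1, x =>
    leg n (InnerProductSpace.rankOne ℂ (η n x.2.1 x.2.2) Ω) (pathTensor η Ω hΩ n x.1)

variable {N : P → h →L[ℂ] h} {η : ℕ → P → ℕ → h} {u : ℕ → h} {Ω : h} (hΩ : ‖Ω‖ = 1)

/-- Slots from `n` on still hold the unit vector `Ω`, which `|Ω⟩⟨Ω|` fixes. -/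
theorem leg_pathTensor {n k : ℕ} (hk : n ≤ k) (x : PathIndex P n) :
    leg k (InnerProductSpace.rankOne ℂ Ω Ω) (pathTensor η Ω hΩ n x) = pathTensor η Ω hΩ n x := by
  induction n with
  | zero =>
    rw [pathTensor, leg_productVec, TensorSeq.act_eq_self]
    simp [hΩ]
  | succ n ih =>
    rw [pathTensor, ← mul_apply_eq_comp, leg_comm (by omega), mul_apply_eq_comp,
      ih (by omega)]

theorem norm_productVec_const :
    ‖productVec (⟨fun _ => Ω, Eventually.of_forall fun _ => hΩ⟩ : TensorSeq h)‖ = 1 := by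
  have h1 := inner_self_eq_norm_sq_to_K (𝕜 := ℂ)
    (productVec (⟨fun _ => Ω, Eventually.of_forall fun _ => hΩ⟩ : TensorSeq h))
  rw [inner_productVec, tensorKernel, if_pos (Eventually.of_forall fun _ => rfl)] at h1
  simp only [inner_self_eq_norm_sq_to_K, hΩ] at h1
  simp only [Complex.coe_algebraMap, Complex.ofReal_one, one_pow, finprod_one] at h1
  have h2 : (1 : ℝ) = ‖productVec (⟨fun _ => Ω, Eventually.of_forall fun _ => hΩ⟩ :
    TensorSeq h)‖ ^ 2 := by exact_mod_cast h1
  exact (pow_eq_one_iff_of_nonneg (norm_nonneg _) two_ne_zero).1 h2.symm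

theorem norm_pathTensor_zero (x : PathIndex P 0) : ‖pathTensor η Ω hΩ 0 x‖ = 1 :=
  norm_productVec_const hΩ

variable [CompleteSpace h]

/-- Since `T` commutes with slot `n`, the adjoint of `|η⟩⟨Ω|` moves past it and `leg_conj_rankOne`
splits off the factor of that slot. -/
theorem inner_pathTensor_succ {n : ℕ} {T : InfTensor h →L[ℂ] InfTensor h}
    (hT : ∀ b, Commute T (leg n b)) (a : h →L[ℂ] h) (x : PathIndex P n) (q : P × ℕ) :
    ⟪pathTensor η Ω hΩ (n + 1) (x, q), (T * leg n a) (pathTensor η Ω hΩ (n + 1) (x, q))⟫_ℂ =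
      ⟪η n q.1 q.2, a (η n q.1 q.2)⟫_ℂ * ⟪pathTensor η Ω hΩ n x, T (pathTensor η Ω hΩ n x)⟫_ℂ := by
  set R := InnerProductSpace.rankOne ℂ (η n q.1 q.2) Ω
  have h1 : pathTensor η Ω hΩ (n + 1) (x, q) = leg n R (pathTensor η Ω hΩ n x) := rfl
  have h2 : star (leg n R) * (T * leg n a) * leg n R =
      T * (⟪η n q.1 q.2, a (η n q.1 q.2)⟫_ℂ • leg n (InnerProductSpace.rankOne ℂ Ω Ω)) := by
    rw [← leg_conj_rankOne, ← mul_assoc, star_leg, (hT (star R)).symm.eq]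
    simp only [mul_assoc]
    rfl
  rw [h1, ← ContinuousLinearMap.adjoint_inner_right, ← ContinuousLinearMap.star_eq_adjoint,
    ← mul_apply_eq_comp, ← mul_apply_eq_comp, h2, mul_apply_eq_comp, smul_apply, map_smul,
    inner_smul_right, leg_pathTensor hΩ le_rfl]

/-- `∑ ⟪ζ, T ζ⟫ ⟪u, y u⟫`, the sum over all paths. -/
noncomputable def pathSum (N : P → h →L[ℂ] h) (η : ℕ → P → ℕ → h) (u : ℕ → h) (hΩ : ‖Ω‖ = 1)
    (n : ℕ) (T : InfTensor h →L[ℂ] InfTensor h) (y : h →L[ℂ] h) : ℂ :=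
  ∑' x : PathIndex P n, ⟪pathTensor η Ω hΩ n x, T (pathTensor η Ω hΩ n x)⟫_ℂ *
    ⟪pathVec N u n x, y (pathVec N u n x)⟫_ℂ

omit [CompleteSpace h] in
theorem inner_pathTensor_mul_nonneg (n : ℕ) {T : InfTensor h →L[ℂ] InfTensor h} (hT : 0 ≤ T)
    {y : h →L[ℂ] h} (hy : 0 ≤ y) (x : PathIndex P n) :
    0 ≤ ⟪pathTensor η Ω hΩ n x, T (pathTensor η Ω hΩ n x)⟫_ℂ *
      ⟪pathVec N u n x, y (pathVec N u n x)⟫_ℂ :=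
  mul_nonneg (ContinuousLinearMap.nonneg_iff_inner.1 hT _)
    (ContinuousLinearMap.nonneg_iff_inner.1 hy _)

omit [CompleteSpace h] in
theorem pathSum_eq_of_support (n : ℕ) {y : h →L[ℂ] h} (T : InfTensor h →L[ℂ] InfTensor h)
    (H : ∀ x : PathIndex P n,
      pathTensor η Ω hΩ n x = 0 ∨ y (pathVec N u n x) = pathVec N u n x) :
    pathSum N η u hΩ n T y = pathSum N η u hΩ n T 1 :=
  tsum_congr fun x => by
    rcases H x with h1 | h1
    · rw [h1]; simp
    · rw [h1]; rfl

variable {E : ℕ → (h →L[ℂ] h) → (h →L[ℂ] h) → (h →L[ℂ] h)} {ρ : ℕ → h →L[ℂ] h}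

namespace IsMixedChain

variable (C : IsMixedChain N η E ρ)
include C

theorem summable_step (n : ℕ) (v : h) :
    Summable fun q : P × ℕ => ‖η n q.1 q.2‖ ^ 2 * ‖N q.1 v‖ ^ 2 := by
  have h1 : ∀ p, Summable fun α => ‖η n p α‖ ^ 2 * ‖N p v‖ ^ 2 := fun p =>
    Summable.mul_right (‖N p v‖ ^ 2) (C.summable_vec n p)
  refine (summable_prod_of_nonneg (fun q => by positivity)).2 ⟨h1, ?_⟩
  refine Summable.of_nonneg_of_le (fun _ => tsum_nonneg fun _ => by positivity) (fun p => ?_)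
    (C.hasSum_norm v).summable
  dsimp only
  rw [tsum_mul_right]
  exact mul_le_of_le_one_left (by positivity) (C.tsum_vec_le n p)

theorem tsum_step_le (n : ℕ) (v : h) :
    ∑' q : P × ℕ, ‖η n q.1 q.2‖ ^ 2 * ‖N q.1 v‖ ^ 2 ≤ ‖v‖ ^ 2 := by
  rw [(C.summable_step n v).tsum_prod, ← (C.hasSum_norm v).tsum_eq]
  refine (C.summable_step n v).prod.tsum_le_tsum (fun p => ?_) (C.hasSum_norm v).summable
  dsimp only
  rw [tsum_mul_right]
  exact mul_le_of_le_one_left (by positivity) (C.tsum_vec_le n p)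

theorem hasSum_step (n : ℕ) (x y : h →L[ℂ] h) (v : h) :
    HasSum (fun q : P × ℕ => ⟪η n q.1 q.2, x (η n q.1 q.2)⟫_ℂ * ⟪N q.1 v, y (N q.1 v)⟫_ℂ)
      ⟪v, E n x y v⟫_ℂ := by
  have hs : Summable fun q : P × ℕ =>
      ⟪η n q.1 q.2, x (η n q.1 q.2)⟫_ℂ * ⟪N q.1 v, y (N q.1 v)⟫_ℂ := by
    refine Summable.of_norm_bounded ((C.summable_step n v).mul_left (‖x‖ * ‖y‖)) fun q => ?_
    rw [norm_mul]
    calc _ ≤ (‖x‖ * (‖η n q.1 q.2‖ * ‖η n q.1 q.2‖)) * (‖y‖ * (‖N q.1 v‖ * ‖N q.1 v‖)) := by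
          gcongr <;> exact norm_inner_apply_le _ _ _
      _ = _ := by ring
  have h1 := hs.hasSum.prod_fiberwise fun p =>
    (summable_inner_apply (C.summable_vec n p) x).hasSum.mul_right ⟪N p v, y (N p v)⟫_ℂ
  rw [(C.hasSum_inner n x y v v).unique h1]
  exact hs.hasSum

theorem summable_path (hu : VecRep u (ρ 0)) (n : ℕ) : Summable fun x : PathIndex P n =>
    ‖pathTensor η Ω hΩ n x‖ ^ 2 * ‖pathVec N u n x‖ ^ 2 := by
  induction n with
  | zero =>
    simp only [norm_pathTensor_zero, pathVec, one_pow, one_mul]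
    exact Equiv.ulift.{w, 0}.summable_iff.2 hu.summable
  | succ n ih =>
    -- Multiplicativity of the norm is the factorisation with `T = 1` and `a = 1`; each further step
    -- then cannot increase the total mass.
    have hz : ∀ (x : PathIndex P n) (q : P × ℕ), ‖pathTensor η Ω hΩ (n + 1) (x, q)‖ ^ 2 =
        ‖pathTensor η Ω hΩ n x‖ ^ 2 * ‖η n q.1 q.2‖ ^ 2 := by
      intro x q
      have := inner_pathTensor_succ (η := η) hΩ (n := n) (T := 1)
        (fun b => Commute.one_left _) 1 x q
      rw [one_mul, leg_one] at this
      simp only [one_apply_eq_self, inner_self_eq_norm_sq_to_K] at this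
      rw [mul_comm]
      exact_mod_cast this
    have he : (fun x : PathIndex P (n + 1) =>
        ‖pathTensor η Ω hΩ (n + 1) x‖ ^ 2 * ‖pathVec N u (n + 1) x‖ ^ 2) =
      fun x : PathIndex P n × (P × ℕ) => ‖pathTensor η Ω hΩ n x.1‖ ^ 2 *
        (‖η n x.2.1 x.2.2‖ ^ 2 * ‖N x.2.1 (pathVec N u n x.1)‖ ^ 2) := by
      funext ⟨x, q⟩
      rw [hz, mul_assoc]
      rfl
    rw [he]
    have h1 : ∀ x : PathIndex P n, Summable fun q : P × ℕ => ‖pathTensor η Ω hΩ n x‖ ^ 2 *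
        (‖η n q.1 q.2‖ ^ 2 * ‖N q.1 (pathVec N u n x)‖ ^ 2) := fun x =>
      Summable.mul_left (‖pathTensor η Ω hΩ n x‖ ^ 2) (C.summable_step n (pathVec N u n x))
    refine (summable_prod_of_nonneg (fun q => by positivity)).2 ⟨h1, ?_⟩
    refine Summable.of_nonneg_of_le (fun _ => tsum_nonneg fun _ => by positivity) (fun x => ?_) ih
    dsimp only
    rw [tsum_mul_left]
    gcongr
    exact C.tsum_step_le n _

theorem summable_pathSum (hu : VecRep u (ρ 0)) (n : ℕ) (T : InfTensor h →L[ℂ] InfTensor h)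
    (y : h →L[ℂ] h) : Summable fun x : PathIndex P n =>
      ⟪pathTensor η Ω hΩ n x, T (pathTensor η Ω hΩ n x)⟫_ℂ *
        ⟪pathVec N u n x, y (pathVec N u n x)⟫_ℂ := by
  refine Summable.of_norm_bounded ((C.summable_path hΩ hu n).mul_left (‖T‖ * ‖y‖)) fun x => ?_
  rw [norm_mul]
  calc _ ≤ (‖T‖ * (‖pathTensor η Ω hΩ n x‖ * ‖pathTensor η Ω hΩ n x‖)) *
        (‖y‖ * (‖pathVec N u n x‖ * ‖pathVec N u n x‖)) := by
        gcongr <;> exact norm_inner_apply_le _ _ _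
    _ = _ := by ring

/-- The last step contributes `⟪η, a η⟫` to the tensor and `Nₚ` to the vector; summing it out by
Fubini produces exactly `E n a y`. This recursion links path sums to nested expectations. -/
theorem pathSum_succ (hu : VecRep u (ρ 0)) {n : ℕ} {T : InfTensor h →L[ℂ] InfTensor h}
    (hT : ∀ b, Commute T (leg n b)) (a y : h →L[ℂ] h) :
    pathSum N η u hΩ (n + 1) (T * leg n a) y = pathSum N η u hΩ n T (E n a y) := by
  have h1 : HasSum (fun x : PathIndex P n × (P × ℕ) =>
      ⟪pathTensor η Ω hΩ (n + 1) x, (T * leg n a) (pathTensor η Ω hΩ (n + 1) x)⟫_ℂ *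
        ⟪pathVec N u (n + 1) x, y (pathVec N u (n + 1) x)⟫_ℂ)
      (pathSum N η u hΩ (n + 1) (T * leg n a) y) :=
    (C.summable_pathSum hΩ hu (n + 1) (T * leg n a) y).hasSum
  refine (h1.prod_fiberwise fun x => ?_).unique (C.summable_pathSum hΩ hu n T (E n a y)).hasSum
  have h2 := (C.hasSum_step n a y (pathVec N u n x)).mul_left
    ⟪pathTensor η Ω hΩ n x, T (pathTensor η Ω hΩ n x)⟫_ℂ
  convert! h2 using 2 with q
  rw [inner_pathTensor_succ hΩ hT, mul_comm (⟪η n q.1 q.2, _⟫_ℂ), mul_assoc]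
  rfl

/-- With `T = 1` the squared tensor norms act as weights, and duality shows by induction that the
weighted path vectors decompose `ρ n`. -/
theorem pathSum_one (hu : VecRep u (ρ 0)) (n : ℕ) (y : h →L[ℂ] h) :
    pathSum N η u hΩ n 1 y = opTrace (ρ n * y) := by
  induction n generalizing y with
  | zero =>
    rw [pathSum, ← (hu.hasSum_trace y).tsum_eq, ← Equiv.ulift.{w, 0}.tsum_eq]
    refine tsum_congr fun x => ?_
    rw [one_apply_eq_self, inner_self_eq_norm_sq_to_K, norm_pathTensor_zero]
    simp [pathVec]
  | succ n ih =>
    have := C.pathSum_succ hΩ hu (n := n) (T := 1) (fun b => Commute.one_left _) 1 y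
    rw [one_mul, leg_one] at this
    rw [this, ih, C.dual]

/-- The expectation of `1 - y ≥ 0` against `ρ n` is a sum of nonnegative terms over paths equal to
zero, so each term vanishes; zero expectation of a positive operator means that the vector is
annihilated. A path whose tensor is zero has no weight and gives no information. -/
theorem apply_pathVec_eq_self (hu : VecRep u (ρ 0)) {n : ℕ} {y : h →L[ℂ] h} (hy : y ≤ 1)
    (htr : opTrace (ρ n * y) = 1) (x : PathIndex P n) :
    pathTensor η Ω hΩ n x = 0 ∨ y (pathVec N u n x) = pathVec N u n x := by
  have hy' : 0 ≤ 1 - y := sub_nonneg.2 hy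
  have h1 := (C.summable_pathSum hΩ hu n 1 1).hasSum.sub (C.summable_pathSum hΩ hu n 1 y).hasSum
  have h2 : HasSum (fun x : PathIndex P n =>
      ⟪pathTensor η Ω hΩ n x, (1 : InfTensor h →L[ℂ] InfTensor h) (pathTensor η Ω hΩ n x)⟫_ℂ *
        ⟪pathVec N u n x, (1 - y) (pathVec N u n x)⟫_ℂ) 0 := by
    convert! h1 using 1
    · funext x
      rw [sub_apply, inner_sub_right, mul_sub]
    · change _ = pathSum N η u hΩ n 1 1 - pathSum N η u hΩ n 1 y
      rw [C.pathSum_one hΩ hu, C.pathSum_one hΩ hu, htr, mul_one, C.trace_eq_one, sub_self]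
  have h3 := (hasSum_zero_iff_of_nonneg
    (fun x => inner_pathTensor_mul_nonneg hΩ n zero_le_one hy' x)).1 h2
  rcases mul_eq_zero.1 (congrFun h3 x) with h4 | h4
  · exact Or.inl (inner_self_eq_zero.1 h4)
  · right
    have := apply_eq_zero_of_inner_eq_zero hy' h4
    rw [sub_apply, sub_eq_zero] at this
    exact this.symm

theorem pathSum_bBar (hu : VecRep u (ρ 0)) (n : ℕ) (T : InfTensor h →L[ℂ] InfTensor h) :
    pathSum N η u hΩ n T (bBar E n) = pathSum N η u hΩ n T 1 := by
  refine pathSum_eq_of_support hΩ n T fun x => ?_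
  by_cases h0 : pathTensor η Ω hΩ n x = 0
  · exact Or.inl h0
  · right
    refine tendsto_nhds_unique (C.tendsto_nestedUnit n _) ?_
    refine tendsto_const_nhds.congr fun k => ?_
    exact (((C.apply_pathVec_eq_self hΩ hu (C.nestedUnit_le_one k n)
      (C.trace_nestedUnit k n)) x).resolve_left h0).symm

/-- Summing out a step that `T` does not see inserts `E n 1 1`, which fixes all path vectors of
nonzero weight. -/
theorem pathSum_consistent (hu : VecRep u (ρ 0)) {n : ℕ} {T : InfTensor h →L[ℂ] InfTensor h}
    (hT : ∀ b, Commute T (leg n b)) :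
    pathSum N η u hΩ (n + 1) T 1 = pathSum N η u hΩ n T 1 := by
  have := C.pathSum_succ hΩ hu hT 1 1
  rw [leg_one, mul_one] at this
  rw [this]
  exact pathSum_eq_of_support hΩ n T
    (C.apply_pathVec_eq_self hΩ hu (C.one_one_le n) (C.trace_nestedUnit 0 n))

theorem pathSum_stable (hu : VecRep u (ρ 0)) {𝓑 : VonNeumannAlgebra h} {n m : ℕ} (hm : n + 1 ≤ m)
    {T : InfTensor h →L[ℂ] InfTensor h} (hT : T ∈ localAlgebra 𝓑 n) :
    pathSum N η u hΩ m T 1 = pathSum N η u hΩ (n + 1) T 1 := by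
  induction m, hm using Nat.le_induction with
  | base => rfl
  | succ m hm ih =>
    rw [← ih]
    exact C.pathSum_consistent hΩ hu fun b => commute_leg_of_mem_localAlgebra hm hT b

theorem trace_nestedExp (hu : VecRep u (ρ 0)) (a : ℕ → h →L[ℂ] h) (n : ℕ) :
    opTrace (ρ 0 * nestedExp E a n 0) = pathSum N η u hΩ (n + 1) (localProduct a n) 1 := by
  have hcomm : ∀ n b, Commute (localProduct a n) (leg (n + 1) b) := fun n b => by
    refine Commute.list_prod_left _ _ fun T hT => ?_
    obtain ⟨k, hk, rfl⟩ := List.mem_map.1 hT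
    have := List.mem_range.1 hk
    exact leg_comm (by omega) _ _
  -- Slots `0, …, m` are already carried by the paths. Each remaining transition is traded for one
  -- more step, and the final `b̄` for `1`.
  have key : ∀ k m, pathSum N η u hΩ (m + 1) (localProduct a m) (nestedExp E a k (m + 1)) =
      pathSum N η u hΩ (m + 1 + k + 1) (localProduct a (m + 1 + k)) 1 := by
    intro k
    induction k with
    | zero =>
      intro m
      rw [nestedExp, ← C.pathSum_succ hΩ hu (hcomm m), ← localProduct_succ, C.pathSum_bBar hΩ hu]
    | succ k ih =>
      intro m
      rw [nestedExp, ← C.pathSum_succ hΩ hu (hcomm m), ← localProduct_succ, ih]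
      congr 2 <;> ring
  have hzero : ∀ y, opTrace (ρ 0 * E 0 (a 0) y) = pathSum N η u hΩ 1 (localProduct a 0) y := by
    intro y
    rw [← C.pathSum_one hΩ hu, ← C.pathSum_succ hΩ hu (fun b => Commute.one_left _), one_mul,
      localProduct_zero]
  rcases n with _ | n
  · rw [nestedExp, hzero, C.pathSum_bBar hΩ hu]
  · rw [nestedExp, hzero, key]
    congr 2 <;> ring

end IsMixedChain

end Paths

/-! ### The state on the infinite tensor product -/

namespace IsMixedChain

variable {h P : Type*} [NormedAddCommGroup h] [InnerProductSpace ℂ h] [CompleteSpace h]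
  {N : P → h →L[ℂ] h} {η : ℕ → P → ℕ → h} {u : ℕ → h} {Ω : h} (hΩ : ‖Ω‖ = 1)
  {E : ℕ → (h →L[ℂ] h) → (h →L[ℂ] h) → (h →L[ℂ] h)} {ρ : ℕ → h →L[ℂ] h}
  (C : IsMixedChain N η E ρ)
include C

/-- On the zero space every trace vanishes, contrary to `trace_eq_one`. The unit vector serves as
placeholder in the slots not yet reached. -/
theorem exists_unit : ∃ Ω : h, ‖Ω‖ = 1 := by
  by_contra! H
  have h0 : ∀ v : h, v = 0 := fun v => by
    by_contra hv
    refine H ((‖v‖⁻¹ : ℂ) • v) ?_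
    rw [norm_smul, norm_inv, Complex.norm_real, norm_norm, inv_mul_cancel₀ (norm_ne_zero_iff.2 hv)]
  have h1 := C.trace_eq_one 0
  rw [opTrace] at h1
  simp [h0] at h1

/-- The weights `‖ζ‖² ‖v‖²` of the paths add up to `Tr(ρ n) = 1`. The bound supplies the compactness
needed for the limit in `n`. -/
theorem norm_pathSum_le (hu : VecRep u (ρ 0)) (n : ℕ) (T : InfTensor h →L[ℂ] InfTensor h) :
    ‖pathSum N η u hΩ n T 1‖ ≤ ‖T‖ := by
  have h1 : HasSum (fun x : PathIndex P n =>
      ‖pathTensor η Ω hΩ n x‖ ^ 2 * ‖pathVec N u n x‖ ^ 2) 1 := by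
    have h2 := (C.summable_pathSum hΩ hu n 1 1).hasSum.mapL Complex.reCLM
    have h3 := C.pathSum_one hΩ hu n 1
    rw [mul_one, C.trace_eq_one] at h3
    rw [pathSum] at h3
    rw [h3] at h2
    convert! h2 using 2 with x
    simp only [one_apply_eq_self, inner_self_eq_norm_sq_to_K]
    simp [← Complex.ofReal_pow, ← Complex.ofReal_mul]
  rw [← mul_one ‖T‖]
  refine tsum_of_norm_bounded (h1.mul_left ‖T‖) fun x => ?_
  rw [norm_mul, one_apply_eq_self, ← mul_assoc]
  gcongr
  · simpa only [sq] using norm_inner_apply_le T (pathTensor η Ω hΩ n x) _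
  · simpa only [sq] using norm_inner_le_norm (𝕜 := ℂ) (pathVec N u n x) _

/-- The mixture of product states is a locally normal state on the infinite tensor product. -/
theorem exists_state (𝓑 : VonNeumannAlgebra h) :
    ∃ φ : (InfTensor h →L[ℂ] InfTensor h) → ℂ,
      IsStateOn (infTensorAlgebra 𝓑) φ ∧
      (∀ a : ℕ → h →L[ℂ] h, (∀ k, a k ∈ 𝓑) → ∀ n,
        φ (localProduct a n) = opTrace (ρ 0 * condExpLocal E a n)) ∧
      IsLocallyNormal 𝓑 φ ∧
      ∀ n, ∀ x ∈ 𝓑, φ (leg n x) = opTrace (ρ n * E n x 1) := by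
  obtain ⟨Ω, hΩ⟩ := C.exists_unit
  obtain ⟨u, hu⟩ := C.exists_rep 0
  -- A limit along a fixed ultrafilter exists for every bounded `T` and inherits linearity and
  -- positivity, so no separate extension from the local algebras to their norm closure is needed.
  have hlim : ∀ T, ∃ z, Tendsto (fun n => pathSum N η u hΩ n T 1) (hyperfilter ℕ) (𝓝 z) := by
    intro T
    obtain ⟨z, -, hz⟩ := (isCompact_closedBall (0 : ℂ) ‖T‖).ultrafilter_le_nhds
      ((hyperfilter ℕ).map fun n => pathSum N η u hΩ n T 1) (by
        rw [le_principal_iff, Ultrafilter.coe_map]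
        exact mem_map.2 (univ_mem' fun n => by
          simpa using C.norm_pathSum_le hΩ hu n T))
    exact ⟨z, hz⟩
  choose φ hφ using hlim
  -- On a local algebra the path sums are eventually constant, so the choice of ultrafilter plays no
  -- role there.
  have hloc : ∀ n, ∀ T ∈ localAlgebra 𝓑 n, φ T = pathSum N η u hΩ (n + 1) T 1 := by
    intro n T hT
    refine tendsto_nhds_unique (hφ T) (tendsto_const_nhds.congr' ?_)
    filter_upwards [Nat.hyperfilter_le_atTop (eventually_ge_atTop (n + 1))] with m hm
    exact (C.pathSum_stable hΩ hu hm hT).symm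
  refine ⟨φ, ⟨fun a _ b _ => ?_, fun c a _ => ?_, fun a _ => ?_, ?_⟩, fun a ha n => ?_,
    fun n => ?_, fun n x hx => ?_⟩
  · refine tendsto_nhds_unique (hφ _) (((hφ a).add (hφ b)).congr fun n => ?_)
    rw [pathSum, pathSum, ← (C.summable_pathSum hΩ hu n a 1).tsum_add
      (C.summable_pathSum hΩ hu n b 1)]
    refine tsum_congr fun x => ?_
    rw [add_apply, inner_add_right, add_mul]
  · refine tendsto_nhds_unique (hφ _) (((hφ a).const_mul c).congr fun n => ?_)
    rw [pathSum, ← tsum_mul_left]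
    refine tsum_congr fun x => ?_
    rw [smul_apply, inner_smul_right, mul_assoc]
  · refine ge_of_tendsto' (hφ _) fun n => tsum_nonneg fun x => ?_
    exact inner_pathTensor_mul_nonneg hΩ n (star_mul_self_nonneg a) zero_le_one x
  · refine tendsto_nhds_unique (hφ _) (tendsto_const_nhds.congr fun n => ?_)
    rw [C.pathSum_one hΩ hu, mul_one, C.trace_eq_one]
  · rw [hloc n _ (localProduct_mem ha n), condExpLocal, C.trace_nestedExp hΩ hu]
  -- Scaling the path tensor by the norm of the path vector turns the path sum into `∑ ⟪v, T v⟫`.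
  · let v : PathIndex P (n + 1) → InfTensor h := fun x =>
      (‖pathVec N u (n + 1) x‖ : ℂ) • pathTensor η Ω hΩ (n + 1) x
    have hv : Summable fun x => ‖v x‖ ^ 2 := by
      refine (C.summable_path hΩ hu (n + 1)).congr fun x => ?_
      rw [norm_smul, Complex.norm_real, norm_norm, mul_pow, mul_comm]
    refine ⟨natReindex v hv, ?_, fun T hT => ?_⟩
    · exact ((hasSum_natReindex v hv (fun z => ‖z‖ ^ 2) (by simp) _).2 hv.hasSum).summable
    · refine (hasSum_natReindex v hv (fun z => ⟪z, T z⟫_ℂ) (by simp) _).2 ?_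
      rw [hloc n T hT]
      convert! (C.summable_pathSum hΩ hu (n + 1) T 1).hasSum using 2 with x
      rw [map_smul, inner_smul_left, inner_smul_right, one_apply_eq_self,
        inner_self_eq_norm_sq_to_K, Complex.conj_ofReal, ← mul_assoc, ← sq, mul_comm]
      rfl
  · rw [hloc n _ (leg_mem_localAlgebra 𝓑 le_rfl hx)]
    have := C.pathSum_succ hΩ hu (n := n) (T := 1) (fun b => Commute.one_left _) x 1
    rw [one_mul] at this
    rw [this, C.pathSum_one hΩ hu]

end IsMixedChain

theorem hasSum_prod_of_nonneg {β γ : Type*} {f : β × γ → ℝ} (hf : ∀ q, 0 ≤ f q) {g : β → ℝ}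
    {a : ℝ} (h1 : ∀ b, HasSum (fun c => f (b, c)) (g b)) (h2 : HasSum g a) : HasSum f a := by
  have hs : Summable f := (summable_prod_of_nonneg hf).2 ⟨fun b => (h1 b).summable, by
    simpa only [fun b => (h1 b).tsum_eq] using h2.summable⟩
  rw [← (hs.hasSum.prod_fiberwise h1).unique h2]
  exact hs.hasSum

theorem hasSum_prod_swap {β γ M : Type*} [AddCommMonoid M] [TopologicalSpace M] {f : β × γ → M}
    {a : M} : HasSum (fun q : γ × β => f (q.2, q.1)) a ↔ HasSum f a :=
  (Equiv.prodComm γ β).hasSum_iff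

/-! ### Operators on `ℓ²(Λ; H)` and the evolution of the walk -/

section Walk

variable {Λ H : Type*} [DecidableEq Λ] [NormedAddCommGroup H] [InnerProductSpace ℂ H]

theorem site_apply (a : H →L[ℂ] H) (i j : Λ) (v : WalkSpace Λ H) :
    site a i j v = lp.single 2 i (a (v j)) := rfl

theorem norm_site_apply (a : H →L[ℂ] H) (i j : Λ) (v : WalkSpace Λ H) :
    ‖site a i j v‖ = ‖a (v j)‖ := by
  rw [site_apply, lp.norm_single (by norm_num)]

omit [DecidableEq Λ] [InnerProductSpace ℂ H] in
theorem hasSum_norm_coord (v : WalkSpace Λ H) : HasSum (fun j => ‖v j‖ ^ 2) (‖v‖ ^ 2) := by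
  simpa using lp.hasSum_norm (p := 2) (by norm_num) v

theorem site_mul_site (a b : H →L[ℂ] H) (i j k : Λ) : site a i j * site b j k = site (a * b) i k := by
  ext1 v
  rw [mul_apply_eq_comp, site_apply, site_apply, site_apply, lp.single_apply_self]
  rfl

theorem site_mul_site_of_ne (a b : H →L[ℂ] H) (i l : Λ) {j k : Λ} (hjk : j ≠ k) :
    site a i j * site b k l = 0 := by
  ext1 v
  rw [mul_apply_eq_comp, site_apply, site_apply, lp.single_apply_ne _ _ _ hjk, map_zero,
    lp.single_zero]
  rfl

variable [CompleteSpace H]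

theorem adjoint_single (j : Λ) :
    ContinuousLinearMap.adjoint (lp.singleContinuousLinearMap ℂ (fun _ : Λ => H) 2 j) =
      lp.evalCLM ℂ (fun _ : Λ => H) 2 j := by
  symm
  refine (ContinuousLinearMap.eq_adjoint_iff _ _).2 fun x y => ?_
  exact (lp.inner_single_right (𝕜 := ℂ) j y x).symm

theorem adjoint_eval (j : Λ) :
    ContinuousLinearMap.adjoint (lp.evalCLM ℂ (fun _ : Λ => H) 2 j) =
      lp.singleContinuousLinearMap ℂ (fun _ : Λ => H) 2 j := by
  rw [← adjoint_single, ContinuousLinearMap.adjoint_adjoint]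

theorem star_site (a : H →L[ℂ] H) (i j : Λ) : star (site a i j) = site (star a) j i := by
  simp only [site, ContinuousLinearMap.star_eq_adjoint, ContinuousLinearMap.adjoint_comp,
    adjoint_single, adjoint_eval]
  rfl

theorem star_site_mul_mul_site (b : H →L[ℂ] H) (i j : Λ) (y : WalkSpace Λ H →L[ℂ] WalkSpace Λ H) :
    star (site b i j) * y * site b i j = site (star b * block y i * b) j j := by
  rw [star_site]
  rfl

/-! ### The algebra of block-diagonal operators -/

theorem commute_site_diagOp (a : Λ → H →L[ℂ] H) (j : Λ) :
    Commute (site 1 j j) (diagOp a) := by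
  refine Commute.tsum_right _ fun i => ?_
  rcases eq_or_ne j i with rfl | hij
  · rw [Commute, SemiconjBy, site_mul_site, site_mul_site, one_mul, mul_one]
  · rw [Commute, SemiconjBy, site_mul_site_of_ne _ _ _ _ hij, site_mul_site_of_ne _ _ _ _ hij.symm]

/-- The block projections commute with the generators and their adjoints, hence with the whole
double commutant. -/
theorem commute_site_of_mem {x : WalkSpace Λ H →L[ℂ] WalkSpace Λ H} (hx : x ∈ blockAlgebra Λ H)
    (j : Λ) : Commute (site 1 j j) x := by
  refine mem_generatedVN.1 hx _ ?_
  rintro _ ⟨a, -, rfl⟩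
  have h1 := commute_site_diagOp a j
  refine ⟨h1.symm, ?_⟩
  have h2 := congrArg star h1.eq
  rwa [star_mul, star_mul, star_site, star_one] at h2

theorem site_mem (a : H →L[ℂ] H) (j : Λ) : site a j j ∈ blockAlgebra Λ H := by
  refine subset_generatedVN _ ⟨Pi.single j a, ?_, ?_⟩
  · refine summable_of_ne_finset_zero (s := {j}) fun _ hi => ?_
    rw [Pi.single_eq_of_ne (by simpa using hi), norm_zero]
  · rw [diagOp, tsum_eq_single j, Pi.single_eq_same]
    intro i hi
    rw [Pi.single_eq_of_ne hi]
    ext1 v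
    rw [site_apply]
    simp

/-- Commutation with a bounded operator passes to strong limits, so a double commutant is strongly
closed. -/
theorem mem_blockAlgebra_of_hasSum {ι : Type*} {T : WalkSpace Λ H →L[ℂ] WalkSpace Λ H}
    {t : ι → WalkSpace Λ H →L[ℂ] WalkSpace Λ H} (ht : ∀ p, t p ∈ blockAlgebra Λ H)
    (hT : ∀ v, HasSum (fun p => t p v) (T v)) : T ∈ blockAlgebra Λ H := by
  refine mem_generatedVN.2 fun z hz => ?_
  ext1 v
  have h1 : (fun p => z (t p v)) = fun p => t p (z v) := funext fun p =>
    DFunLike.congr_fun (mem_generatedVN.1 (ht p) z hz) v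
  refine ((hT v).mapL z).unique ?_
  rw [h1]
  exact hT (z v)

/-- Commutation with the block projections removes the off-diagonal terms of the quadratic form. -/
theorem hasSum_inner_site {x : WalkSpace Λ H →L[ℂ] WalkSpace Λ H} (hx : x ∈ blockAlgebra Λ H)
    (v : WalkSpace Λ H) :
    HasSum (fun j => ⟪lp.single 2 j (v j), x (lp.single 2 j (v j))⟫_ℂ) ⟪v, x v⟫_ℂ := by
  have h1 := ((lp.hasSum_single (p := 2) ENNReal.ofNat_ne_top v).mapL x).mapL (innerSL ℂ v)
  convert! h1 using 2 with j
  have h2 : lp.single 2 j (v j) = site 1 j j v := rfl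
  have h3 : site 1 j j (site 1 j j v) = site 1 j j v := by
    rw [← mul_apply_eq_comp, site_mul_site, one_mul]
  rw [h2, innerSL_apply_apply]
  conv_rhs => rw [← h3, ← mul_apply_eq_comp x, ← (commute_site_of_mem hx j).eq, mul_apply_eq_comp,
    ← ContinuousLinearMap.adjoint_inner_left, ← ContinuousLinearMap.star_eq_adjoint, star_site,
    star_one]

/-! ### The evolution of the states -/

section Evolution

variable {B : Λ → Λ → H →L[ℂ] H} (hB : ∀ j v, HasSum (fun i => (star (B i j) * B i j) v) v)
include hB

omit [DecidableEq Λ] in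
theorem hasSum_norm_column (j : Λ) (v : H) : HasSum (fun i => ‖B i j v‖ ^ 2) (‖v‖ ^ 2) := by
  have h1 := ((hB j v).mapL (innerSL ℂ v)).mapL Complex.reCLM
  convert! h1 using 1
  · funext i
    simp only [mul_apply_eq_comp, innerSL_apply_apply, ContinuousLinearMap.star_eq_adjoint,
      ContinuousLinearMap.adjoint_inner_right]
    exact (inner_self_eq_norm_sq (𝕜 := ℂ) _).symm
  · exact (inner_self_eq_norm_sq (𝕜 := ℂ) _).symm

/-- For each source `j` the column `(B i j)ᵢ` is isometric, and the coordinates of `v` at different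
sites are orthogonal. -/
theorem hasSum_norm_site_apply (v : WalkSpace Λ H) :
    HasSum (fun p : Λ × Λ => ‖site (B p.1 p.2) p.1 p.2 v‖ ^ 2) (‖v‖ ^ 2) := by
  rw [← hasSum_prod_swap]
  refine hasSum_prod_of_nonneg (fun q => by positivity) (fun j => ?_) (hasSum_norm_coord v)
  simpa only [norm_site_apply] using hasSum_norm_column hB j (v j)

theorem VecRep.walkMap {ι : Type*} {w : ι → WalkSpace Λ H}
    {ρ : WalkSpace Λ H →L[ℂ] WalkSpace Λ H} (hw : VecRep w ρ) :
    VecRep (fun q : (Λ × Λ) × ι => site (B q.1.1 q.1.2) q.1.1 q.1.2 (w q.2)) (walkMap B ρ) := by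
  refine VecRep.tsum (fun p : Λ × Λ => hw.conj (site (B p.1 p.2) p.1 p.2)) ?_
  have h1 : HasSum (fun q : ι × (Λ × Λ) => ‖site (B q.2.1 q.2.2) q.2.1 q.2.2 (w q.1)‖ ^ 2)
      (∑' α, ‖w α‖ ^ 2) :=
    hasSum_prod_of_nonneg (fun q => by positivity) (fun α => hasSum_norm_site_apply hB (w α))
      hw.summable.hasSum
  exact (hasSum_prod_swap.2 h1).summable

theorem opTrace_walkMap {ι : Type*} {w : ι → WalkSpace Λ H}
    {ρ : WalkSpace Λ H →L[ℂ] WalkSpace Λ H} (hw : VecRep w ρ) :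
    opTrace (walkMap B ρ) = opTrace ρ := by
  have h1 : HasSum (fun q : ι × (Λ × Λ) => ‖site (B q.2.1 q.2.2) q.2.1 q.2.2 (w q.1)‖ ^ 2)
      (opTrace ρ).re :=
    hasSum_prod_of_nonneg (fun q => by positivity) (fun α => hasSum_norm_site_apply hB (w α))
      hw.hasSum_norm
  refine Complex.ext ?_ ?_
  · exact (hw.walkMap hB).hasSum_norm.unique (hasSum_prod_swap.2 h1)
  · rw [(hw.walkMap hB).trace_im, hw.trace_im]

end Evolution

theorem vecRep_diagOp {r : Λ → H →L[ℂ] H} (hr_nonneg : ∀ i, 0 ≤ r i)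
    (hr_trace : ∀ i, IsTraceClass (r i)) (hr_sum : HasSum (fun i => opTrace (r i)) 1) :
    ∃ w : ℕ → WalkSpace Λ H, VecRep w (diagOp r) ∧ opTrace (diagOp r) = 1 := by
  have h1 := fun i => (hr_trace i).vecRep (hr_nonneg i)
  have h2 : ∀ i, VecRep (fun k => lp.single 2 i (CFC.sqrt (r i) (stdBasis H k)))
      (site (r i) i i) := fun i => by
    have := (h1 i).conj (lp.singleContinuousLinearMap ℂ (fun _ : Λ => H) 2 i)
    rwa [adjoint_single] at this
  have h3 : HasSum (fun q : Λ × basisIndex H =>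
      ‖lp.single (E := fun _ : Λ => H) 2 q.1 (CFC.sqrt (r q.1) (stdBasis H q.2))‖ ^ 2) 1 := by
    refine hasSum_prod_of_nonneg (fun q => by positivity) (fun i => ?_)
      (hr_sum.mapL Complex.reCLM)
    simp only [lp.norm_single (E := fun _ : Λ => H) (p := 2) (by norm_num)]
    exact (h1 i).hasSum_norm
  have h4 := VecRep.tsum h2 h3.summable
  refine ⟨_, h4.reindex, Complex.ext ?_ ?_⟩
  · exact h4.hasSum_norm.unique h3
  · rw [Complex.one_im]; exact h4.trace_im

end Walk

/-! ### The transition expectations of the walk -/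

section Transition

variable {Λ H : Type*} [DecidableEq Λ] [NormedAddCommGroup H] [InnerProductSpace ℂ H]
  [CompleteSpace H]

/-- If `ρ = ∑ |w_α⟩⟨w_α|`, these vectors represent the normalised block `ρ_j / Tr ρ_j` at `j`. -/
noncomputable def siteVec (w : ℕ → WalkSpace Λ H) (ρ : WalkSpace Λ H →L[ℂ] WalkSpace Λ H) (j : Λ)
    (α : ℕ) : WalkSpace Λ H :=
  (((Real.sqrt (opTrace (block ρ j)).re)⁻¹ : ℝ) : ℂ) • lp.single 2 j (w α j)

/-- `Tr((ρ_j ⊗ |j⟩⟨j|) x) / Tr(ρ_j)`. -/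
noncomputable def siteWeight (ρ : WalkSpace Λ H →L[ℂ] WalkSpace Λ H) (j : Λ)
    (x : WalkSpace Λ H →L[ℂ] WalkSpace Λ H) : ℂ :=
  opTrace (site (block ρ j) j j * x) / opTrace (block ρ j)

section Site

variable {w : ℕ → WalkSpace Λ H} {ρ : WalkSpace Λ H →L[ℂ] WalkSpace Λ H} (hw : VecRep w ρ)
include hw

theorem VecRep.block (j : Λ) : VecRep (fun α => w α j) (block ρ j) := by
  have := hw.conj (lp.evalCLM ℂ (fun _ : Λ => H) 2 j)
  rwa [adjoint_eval] at this

theorem VecRep.site_block (j : Λ) :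
    VecRep (fun α => lp.single 2 j (w α j)) (site (_root_.block ρ j) j j) := by
  have := (hw.block j).conj (lp.singleContinuousLinearMap ℂ (fun _ : Λ => H) 2 j)
  rwa [adjoint_single] at this

theorem opTrace_block_eq (j : Λ) : opTrace (block ρ j) = ((opTrace (block ρ j)).re : ℂ) :=
  Complex.ext rfl (by rw [(hw.block j).trace_im, Complex.ofReal_im])

theorem opTrace_block_nonneg (j : Λ) : 0 ≤ (opTrace (block ρ j)).re :=
  (hw.block j).hasSum_norm.nonneg fun _ => by positivity

/-- The trace of the block is `∑ ‖w_α j‖²`, so no vector of the decomposition charges a site of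
trace zero. -/
theorem coord_eq_zero {j : Λ} (h : (opTrace (block ρ j)).re = 0) (α : ℕ) : w α j = 0 := by
  have h1 := (hw.block j).hasSum_norm
  rw [h, hasSum_zero_iff_of_nonneg fun _ => by positivity] at h1
  simpa using congrFun h1 α

theorem hasSum_siteWeight (j : Λ) (x : WalkSpace Λ H →L[ℂ] WalkSpace Λ H) :
    HasSum (fun α => ⟪siteVec w ρ j α, x (siteVec w ρ j α)⟫_ℂ) (siteWeight ρ j x) := by
  have h1 := ((hw.site_block j).hasSum_trace x).mul_right (opTrace (block ρ j))⁻¹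
  rw [siteWeight, div_eq_mul_inv]
  convert! h1 using 2 with α
  rw [siteVec, map_smul, inner_smul_left, inner_smul_right, Complex.conj_ofReal, ← mul_assoc,
    ← Complex.ofReal_mul, ← mul_inv, Real.mul_self_sqrt (opTrace_block_nonneg hw j),
    opTrace_block_eq hw j, mul_comm, Complex.ofReal_inv, Complex.ofReal_re]

/-- The total is left as `t⁻¹ * t` because it is `1` at a charged site but `0` at a null site, where
the inverse is `0`. -/
theorem hasSum_norm_siteVec (j : Λ) : HasSum (fun α => ‖siteVec w ρ j α‖ ^ 2)
    ((opTrace (block ρ j)).re⁻¹ * (opTrace (block ρ j)).re) := by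
  convert! (hw.block j).hasSum_norm.mul_left (opTrace (block ρ j)).re⁻¹ using 2 with α
  rw [siteVec, norm_smul, Complex.norm_real, lp.norm_single (by norm_num), mul_pow, norm_inv,
    Real.norm_of_nonneg (Real.sqrt_nonneg _), inv_pow, Real.sq_sqrt (opTrace_block_nonneg hw j)]

theorem tsum_norm_siteVec_le (j : Λ) : ∑' α, ‖siteVec w ρ j α‖ ^ 2 ≤ 1 := by
  rw [(hasSum_norm_siteVec hw j).tsum_eq]
  exact inv_mul_le_one

theorem norm_siteWeight_le (j : Λ) (x : WalkSpace Λ H →L[ℂ] WalkSpace Λ H) :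
    ‖siteWeight ρ j x‖ ≤ ‖x‖ := by
  rw [← (hasSum_siteWeight hw j x).tsum_eq]
  refine (tsum_of_norm_bounded ((hasSum_norm_siteVec hw j).mul_left ‖x‖) fun α => ?_).trans ?_
  · simpa only [sq] using norm_inner_apply_le x (siteVec w ρ j α) _
  · exact mul_le_of_le_one_right (norm_nonneg _) inv_mul_le_one

theorem siteWeight_one {j : Λ} (h : (opTrace (block ρ j)).re ≠ 0) : siteWeight ρ j 1 = 1 := by
  have h1 := (hasSum_siteWeight hw j 1).tsum_eq
  rw [tsum_inner_one_apply, (hasSum_norm_siteVec hw j).tsum_eq, inv_mul_cancel₀ h] at h1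
  rw [← h1, Complex.ofReal_one]

theorem siteWeight_mul (j : Λ) (x : WalkSpace Λ H →L[ℂ] WalkSpace Λ H) :
    siteWeight ρ j x * opTrace (block ρ j) = opTrace (site (block ρ j) j j * x) := by
  by_cases h : (opTrace (block ρ j)).re = 0
  · rw [opTrace_block_eq hw, h, Complex.ofReal_zero, mul_zero]
    refine HasSum.unique ?_ ((hw.site_block j).hasSum_trace x)
    simp [coord_eq_zero hw h]
  · refine div_mul_cancel₀ _ ?_
    rw [opTrace_block_eq hw]
    exact_mod_cast h

end Site

variable {B : Λ → Λ → H →L[ℂ] H} (hB : ∀ j v, HasSum (fun i => (star (B i j) * B i j) v) v)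
  {r : Λ → H →L[ℂ] H}
include hB

/-- The sum may run over all sites: at a zero block the weight is a quotient by zero, hence `0`.
Convergence follows from the isometric column `(M^i_j)` and the bound `‖x‖` on the weights. -/
theorem hasSum_walkTransition {n : ℕ} {w : ℕ → WalkSpace Λ H} (hw : VecRep w (walkState B r n))
    (x y : WalkSpace Λ H →L[ℂ] WalkSpace Λ H) (v : WalkSpace Λ H) :
    HasSum (fun p : Λ × Λ => (siteWeight (walkState B r n) p.2 x •
      (star (site (B p.1 p.2) p.1 p.2) * y * site (B p.1 p.2) p.1 p.2)) v)
      (walkTransition B r n x y v) := by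
  obtain ⟨T, hT⟩ := exists_hasSum_adjoint_comp
    (fun p : Λ × Λ => site (B p.1 p.2) p.1 p.2)
    (fun s v => sum_le_hasSum s (fun _ _ => by positivity) (hasSum_norm_site_apply hB v))
    (fun p => siteWeight (walkState B r n) p.2 x • y) (‖x‖ * ‖y‖)
    (fun p => by rw [norm_smul]; gcongr; exact norm_siteWeight_le hw _ _)
  have h1 : ∀ v, HasSum (fun p : Λ × Λ => (siteWeight (walkState B r n) p.2 x •
      (star (site (B p.1 p.2) p.1 p.2) * y * site (B p.1 p.2) p.1 p.2)) v) (T v) := by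
    intro v
    convert! hT v using 2 with p
    rw [smul_apply, smul_apply, map_smul]
    rfl
  have h2 : walkTransition B r n x y = T := by
    refine strongSum_eq fun v => ?_
    have hinj : Function.Injective
        fun q : {j : Λ // block (walkState B r n) j ≠ 0} × Λ => (q.2, q.1.1) := by
      rintro ⟨⟨j, hj⟩, i⟩ ⟨⟨j', hj'⟩, i'⟩ h
      simp only [Prod.mk.injEq] at h
      obtain ⟨rfl, rfl⟩ := h
      rfl
    refine (hinj.hasSum_iff ?_).2 (h1 v)
    rintro ⟨i, j⟩ hij
    have h0 : block (walkState B r n) j = 0 := by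
      by_contra hne
      exact hij ⟨(⟨j, hne⟩, i), rfl⟩
    have h3 : opTrace (0 : H →L[ℂ] H) = 0 := by simp [opTrace]
    rw [siteWeight, h0, h3, div_zero, zero_smul, zero_apply]
  rw [h2]
  exact h1 v

theorem walkTransition_mem {n : ℕ} {w : ℕ → WalkSpace Λ H} (hw : VecRep w (walkState B r n))
    (x y : WalkSpace Λ H →L[ℂ] WalkSpace Λ H) : walkTransition B r n x y ∈ blockAlgebra Λ H := by
  refine mem_blockAlgebra_of_hasSum (fun p => ?_) (hasSum_walkTransition hB hw x y)
  rw [star_site_mul_mul_site]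
  have := (blockAlgebra Λ H).toStarSubalgebra.smul_mem
    (site_mem (star (B p.1 p.2) * block y p.1 * B p.1 p.2) p.2)
    (siteWeight (walkState B r n) p.2 x)
  exact this

theorem hasSum_inner_walkTransition {n : ℕ} {w : ℕ → WalkSpace Λ H}
    (hw : VecRep w (walkState B r n)) (x y : WalkSpace Λ H →L[ℂ] WalkSpace Λ H)
    (v v' : WalkSpace Λ H) :
    HasSum (fun p : Λ × Λ => siteWeight (walkState B r n) p.2 x *
      ⟪site (B p.1 p.2) p.1 p.2 v, y (site (B p.1 p.2) p.1 p.2 v')⟫_ℂ)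
      ⟪v, walkTransition B r n x y v'⟫_ℂ := by
  convert! (hasSum_walkTransition hB hw x y v').mapL (innerSL ℂ v) using 2 with p
  rw [innerSL_apply_apply, smul_apply, inner_smul_right, mul_apply_eq_comp, mul_apply_eq_comp,
    ContinuousLinearMap.star_eq_adjoint, ContinuousLinearMap.adjoint_inner_right]

/-- At `x = 1` the weight is `1` on charged sites, and on null sites the vectors `w_α` vanish; so
the weights can be dropped, leaving `Tr(𝓜(ρ) y)`. -/
theorem opTrace_walkState_succ {n : ℕ} {w : ℕ → WalkSpace Λ H} (hw : VecRep w (walkState B r n))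
    (y : WalkSpace Λ H →L[ℂ] WalkSpace Λ H) :
    opTrace (walkState B r (n + 1) * y) = opTrace (walkState B r n * walkTransition B r n 1 y) := by
  have h1 := hasSum_prod_swap.2 ((hw.walkMap hB).hasSum_trace y)
  rw [walkState, Function.iterate_succ_apply', ← walkState]
  refine (h1.prod_fiberwise fun α => ?_).unique (hw.hasSum_trace _)
  convert! hasSum_inner_walkTransition hB hw 1 y (w α) (w α) using 2 with p
  by_cases h : (opTrace (block (walkState B r n) p.2)).re = 0
  · have : site (B p.1 p.2) p.1 p.2 (w α) = 0 := by
      rw [← norm_eq_zero, norm_site_apply, coord_eq_zero hw h, map_zero, norm_zero]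
    rw [this]
    simp
  · rw [siteWeight_one hw h, one_mul]

/-- Isometry of the columns collapses the sum over targets to `∑ⱼ cⱼ(x) Tr(ρ_j) = ∑ⱼ Tr((ρ_j ⊗
|j⟩⟨j|) x)`, and this is `Tr(ρ x)` because `x` is block-diagonal. -/
theorem opTrace_walkTransition_one {n : ℕ} {w : ℕ → WalkSpace Λ H}
    (hw : VecRep w (walkState B r n)) {x : WalkSpace Λ H →L[ℂ] WalkSpace Λ H}
    (hx : x ∈ blockAlgebra Λ H) :
    opTrace (walkState B r n * walkTransition B r n x 1) = opTrace (walkState B r n * x) := by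
  have hs : Summable fun q : ℕ × Λ => ‖w q.1 q.2‖ ^ 2 :=
    (hasSum_prod_of_nonneg (fun q => by positivity) (fun α => hasSum_norm_coord (w α))
      hw.summable.hasSum).summable
  have h1 : Summable fun q : ℕ × Λ =>
      siteWeight (walkState B r n) q.2 x * ((‖w q.1 q.2‖ ^ 2 : ℝ) : ℂ) := by
    refine Summable.of_norm_bounded (hs.mul_left ‖x‖) fun q => ?_
    rw [norm_mul, Complex.norm_real, Real.norm_of_nonneg (by positivity)]
    gcongr
    exact norm_siteWeight_le hw _ _
  have h2 : Summable fun q : ℕ × Λ =>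
      ⟪lp.single (E := fun _ : Λ => H) 2 q.2 (w q.1 q.2), x (lp.single 2 q.2 (w q.1 q.2))⟫_ℂ := by
    refine Summable.of_norm_bounded (hs.mul_left ‖x‖) fun q => ?_
    refine (norm_inner_apply_le _ _ _).trans ?_
    rw [lp.norm_single (by norm_num), sq]
  have h3 : ∀ α, HasSum (fun j => siteWeight (walkState B r n) j x * ((‖w α j‖ ^ 2 : ℝ) : ℂ))
      ⟪w α, walkTransition B r n x 1 (w α)⟫_ℂ := by
    intro α
    refine (hasSum_prod_swap.2
      (hasSum_inner_walkTransition hB hw x 1 (w α) (w α))).prod_fiberwise fun j => ?_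
    have := ((hasSum_norm_column hB j (w α j)).mapL Complex.ofRealCLM).mul_left
      (siteWeight (walkState B r n) j x)
    convert! this using 3 with i
    rw [one_apply_eq_self, inner_self_eq_norm_sq_to_K, norm_site_apply]
    simp
  rw [(hw.hasSum_trace _).unique (h1.hasSum.prod_fiberwise h3),
    (hw.hasSum_trace _).unique (h2.hasSum.prod_fiberwise fun α => hasSum_inner_site hx (w α))]
  -- Both traces are now double sums over `(α, j)`; they are compared by summing over `α` first,
  -- site by site.
  refine (HasSum.unique ((hasSum_prod_swap.2 h1.hasSum).prod_fiberwise fun j => ?_)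
    ((hasSum_prod_swap.2 h2.hasSum).prod_fiberwise fun j => (hw.site_block j).hasSum_trace x))
  have := ((hw.block j).hasSum_norm.mapL Complex.ofRealCLM).mul_left
    (siteWeight (walkState B r n) j x)
  rw [← siteWeight_mul hw, opTrace_block_eq hw]
  exact this

end Transition

/-! ### The walk as a mixed chain, and the theorem -/

section Main

variable {Λ H : Type*} [DecidableEq Λ] [NormedAddCommGroup H] [InnerProductSpace ℂ H]
  [CompleteSpace H] {B : Λ → Λ → H →L[ℂ] H} {r : Λ → H →L[ℂ] H}

theorem exists_vecRep_walkState (hB : ∀ j v, HasSum (fun i => (star (B i j) * B i j) v) v)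
    (hr_nonneg : ∀ i, 0 ≤ r i) (hr_trace : ∀ i, IsTraceClass (r i))
    (hr_sum : HasSum (fun i => opTrace (r i)) 1) (n : ℕ) :
    ∃ w : ℕ → WalkSpace Λ H, VecRep w (walkState B r n) ∧ opTrace (walkState B r n) = 1 := by
  induction n with
  | zero => exact vecRep_diagOp hr_nonneg hr_trace hr_sum
  | succ n ih =>
    obtain ⟨w, hw, htr⟩ := ih
    rw [walkState, Function.iterate_succ_apply', ← walkState]
    exact ⟨_, (hw.walkMap hB).reindex, (opTrace_walkMap hB hw).trans htr⟩

theorem isMixedChain_walk (hB : ∀ j v, HasSum (fun i => (star (B i j) * B i j) v) v)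
    {w : ℕ → ℕ → WalkSpace Λ H} (hw : ∀ n, VecRep (w n) (walkState B r n))
    (htr : ∀ n, opTrace (walkState B r n) = 1) :
    IsMixedChain (fun p : Λ × Λ => site (B p.1 p.2) p.1 p.2)
      (fun n p => siteVec (w n) (walkState B r n) p.2) (walkTransition B r) (walkState B r) where
  hasSum_norm := hasSum_norm_site_apply hB
  summable_vec n p := (hasSum_norm_siteVec (hw n) p.2).summable
  tsum_vec_le n p := tsum_norm_siteVec_le (hw n) p.2
  hasSum_inner n x y v v' := by
    simpa only [fun p : Λ × Λ => (hasSum_siteWeight (hw n) p.2 x).tsum_eq] using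
      hasSum_inner_walkTransition hB (hw n) x y v v'
  dual n y := opTrace_walkState_succ hB (hw n) y
  exists_rep n := ⟨w n, hw n⟩
  trace_eq_one := htr

theorem VecRep.isStateOn {h ι : Type*} [NormedAddCommGroup h] [InnerProductSpace ℂ h]
    [CompleteSpace h] {w : ι → h} {ρ : h →L[ℂ] h} (hw : VecRep w ρ) (htr : opTrace ρ = 1)
    (A : StarSubalgebra ℂ (h →L[ℂ] h)) : IsStateOn A (traceFunctional ρ) where
  map_add a _ b _ := by
    refine (hw.hasSum_trace (a + b)).unique ?_
    convert! (hw.hasSum_trace a).add (hw.hasSum_trace b) using 2 with α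
    rw [add_apply, inner_add_right]
  map_smul c a _ := by
    refine (hw.hasSum_trace (c • a)).unique ?_
    convert! (hw.hasSum_trace a).mul_left c using 2 with α
    rw [smul_apply, inner_smul_right]
  nonneg a _ := (hw.hasSum_trace (star a * a)).nonneg fun α =>
    ContinuousLinearMap.nonneg_iff_inner.1 (star_mul_self_nonneg a) _
  map_one := by rw [traceFunctional, mul_one, htr]

end Main

theorem mainTheorem5 {Λ H : Type*} [Countable Λ] [DecidableEq Λ]
    [NormedAddCommGroup H] [InnerProductSpace ℂ H] [CompleteSpace H]
    [TopologicalSpace.SeparableSpace H]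
    (B : Λ → Λ → H →L[ℂ] H)
    (hB : ∀ j v, HasSum (fun i => (star (B i j) * B i j) v) v)
    (r : Λ → H →L[ℂ] H) (hr_nonneg : ∀ i, 0 ≤ r i) (hr_trace : ∀ i, IsTraceClass (r i))
    (hr_sum : HasSum (fun i => opTrace (r i)) 1) :
    (∀ n, IsDensity (walkState B r n)) ∧
    (∀ n, ∀ x ∈ blockAlgebra Λ H,
      qmcValue (traceFunctional (walkState B r 0)) (walkTransition B r) (Function.update 1 n x) =
        opTrace (walkState B r n * x)) ∧
    IsMarkovPair (blockAlgebra Λ H) (traceFunctional (walkState B r 0)) (walkTransition B r) ∧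
    ∃ φ : (InfTensor (WalkSpace Λ H) →L[ℂ] InfTensor (WalkSpace Λ H)) → ℂ,
      IsQMCState (blockAlgebra Λ H) (traceFunctional (walkState B r 0)) (walkTransition B r) φ ∧
      IsLocallyNormal (blockAlgebra Λ H) φ ∧
      ∀ n, ∀ x ∈ blockAlgebra Λ H, φ (leg n x) = opTrace (walkState B r n * x) := by
  choose w hw htr using exists_vecRep_walkState hB hr_nonneg hr_trace hr_sum
  have C := isMixedChain_walk hB hw htr
  obtain ⟨φ, hstate, hprod, hnormal, hleg⟩ := C.exists_state (blockAlgebra Λ H)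
  have hleg' : ∀ n, ∀ x ∈ blockAlgebra Λ H, φ (leg n x) = opTrace (walkState B r n * x) :=
    fun n x hx => (hleg n x hx).trans (opTrace_walkTransition_one hB (hw n) hx)
  have hvalue : ∀ n, ∀ x ∈ blockAlgebra Λ H,
      qmcValue (traceFunctional (walkState B r 0)) (walkTransition B r) (Function.update 1 n x) =
        opTrace (walkState B r n * x) := by
    intro n x hx
    -- The value on one slot is read off from `φ` on the local product with units in the other
    -- slots.
    rw [← hleg' n x hx, ← localProduct_update_one, hprod, qmcValue, C.condExp₀_update_one]
    · rfl
    · intro k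
      rcases eq_or_ne k n with rfl | hk
      · rwa [Function.update_self]
      · rw [Function.update_of_ne hk]
        exact one_mem _
  refine ⟨fun n => ⟨(hw n).nonneg, (hw n).isTraceClass, htr n⟩, hvalue, ⟨?_, fun n => ?_, ?_, ?_⟩,
    φ, ⟨hstate, hprod⟩, hnormal, hleg'⟩
  · exact (hw 0).isStateOn (htr 0) _
  · exact C.isTransitionExpectation n (walkTransition_mem hB (hw n))
  · have := hvalue 0 1 (one_mem _)
    rwa [mul_one, htr, show Function.update (1 : ℕ → WalkSpace Λ H →L[ℂ] WalkSpace Λ H) 0 1 = 1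
      from Function.update_eq_self 0 (1 : ℕ → WalkSpace Λ H →L[ℂ] WalkSpace Λ H)] at this
  · exact ⟨φ, hstate, hprod⟩
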